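/- Let $I\subset\mathbb{R}$ be a compact interval with non-empty interior and let $\ell,d\in C^2(I;\mathbb{R})$ with $\ell(t)>0$ for all $t\in I$. For $\ell>0$, $d\in\mathbb{R}$ put $\Omega_{\ell,d}=[d-\ell/2,\,d+\ell/2]$, $\Omega=\Omega_{1,0}$, and let $H_{\ell,d}=-\frac{\mathrm{d}^2}{\mathrm{d}x^2}$ on $L^2(\Omega_{\ell,d})$ with domain $H^1_0(\Omega_{\ell,d})\cap H^2(\Omega_{\ell,d})$ (the nonnegative Dirichlet Laplacian). Let $W_{\ell,d}:L^2(\Omega_{\ell,d})\to L^2(\Omega)$ be the unitary operator $(W_{\ell,d}\Phi)(x)=\sqrt{\ell}\,\Phi(\ell x+d)$. On $L^2(\Omega)$ let $$\tilde H(t)=\frac{1}{\ell(t)^2}\Delta_{\rm Dir}-\frac{\dot\ell(t)}{\ell(t)}\,x\circ p-\frac{\dot d(t)}{\ell(t)}\,p,\qquad \mathcal D(\tilde H(t))=H^1_0(\Omega)\cap H^2(\Omega),$$ where $\Delta_{\rm Dir}=-\frac{\mathrm{d}^2}{\mathrm{d}x^2}$ is the Dirichlet Laplacian on $\Omega$,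 $p=-\mathrm{i}\frac{\mathrm{d}}{\mathrm{d}x}$, and $x\circ p=\frac12(xp+px)$. A unitary propagator on a family of Hilbert spaces $\mathcal H_t$, $t\in I$, is a family of unitary operators $U(t,s):\mathcal H_s\to\mathcal H_t$, $t,s\in I$, with $U(t,s)U(s,r)=U(t,r)$ that is jointly strongly continuous in $(t,s)$; when $\mathcal H_t=L^2(\Omega_{\ell(t),d(t)})$, continuity and scalar products between different times are taken in $L^2(\mathbb R)$ after extension by zero (and $U(t,s)$ is precomposed with the restriction to $\Omega_{\ell(s),d(s)}$). It is a weak solution of the Schrödinger equation $\mathrm{i}\dot\Psi(t)=A(t)\Psi(t)$ generated by semibounded self-adjoint operators $A(t)$ on $\mathcal H_t$, with associated closed forms $h_t$ on the form domains $\mathcal H^+_t$, if for all $s\in I$ and $\Psi_0\in\mathcal H^+_s$ the function $\Psi(t)=U(t,s)\Psi_0$ satisfies $\Psi(s)=\Psi_0$ and, for all $t\in I$, $\Psi(t)\in\mathcal H^+_t$ and $$\mathrm{i}\,\frac{\mathrm d}{\mathrm dr}\langle\Phi,\Psi(r)\rangle\Big|_{r=t}=h_t(\Phi,\Psi(t))\qquad\text{for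 all }\Phi\in\mathcal H^+_t$$ (one-sided derivatives at the end points of $I$). Let $\tilde U(t,s)$, $t,s\in I$, be a weak solution of the Schrödinger equation generated by $\tilde H(t)$ on $L^2(\Omega)$. Then the operators $H_{\ell(t),d(t)}$, $t\in I$, are densely defined, self-adjoint and uniformly semibounded from below, and $$U(t,s):=W^\dagger_{\ell(t),d(t)}\,\tilde U(t,s)\,W_{\ell(s),d(s)},\qquad t,s\in I,$$ is a unitary propagator and a weak solution of the Schrödinger equation generated by $H_{\ell(t),d(t)}$ on the spaces $L^2(\Omega_{\ell(t),d(t)})$. -/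

import Mathlib

open MeasureTheory Filter Topology Set
open scoped ContDiff

noncomputable section

namespace MovingBox

/-! ### Abstract notions: forms, propagators, weak solutions

A (possibly time-dependent) Hilbert space is a family `𝓗 t` together with isometric embeddings
`J t : 𝓗 t → K` into one fixed Hilbert space `K`. A fixed Hilbert space is the case of a constant
family with `J t = id`. -/

section Form

variable {H : Type*} [NormedAddCommGroup H] [InnerProductSpace ℂ H]

/-- The quadratic form `ψ ↦ ⟨ψ, A ψ⟩` of an operator `A`. -/
def quadForm (A : H →ₗ.[ℂ] H) (ψ : A.domain) : ℂ := inner ℂ (ψ : H) (A ψ)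

/-- `u n ∈ 𝒟(A)` converges to `ψ` in `H` and is Cauchy for the quadratic form of `A`. -/
def FormApprox (A : H →ₗ.[ℂ] H) (ψ : H) (u : ℕ → A.domain) : Prop :=
  Tendsto (fun n => (u n : H)) atTop (𝓝 ψ) ∧
    Tendsto (fun p : ℕ × ℕ => quadForm A (u p.1 - u p.2)) atTop (𝓝 0)

/-- The form domain of a semibounded symmetric operator `A`: the domain of the closure of the
quadratic form of `A`. -/
def formDomain (A : H →ₗ.[ℂ] H) : Set H := {ψ | ∃ u, FormApprox A ψ u}

/-- `z = h(φ, ψ)`, where `h` is the closed sesquilinear form (antilinear on the left) associated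
with the semibounded symmetric operator `A`, that is, the closure of `φ, ψ ↦ ⟨φ, A ψ⟩`. -/
def IsFormValue (A : H →ₗ.[ℂ] H) (φ ψ : H) (z : ℂ) : Prop :=
  ∃ u v, FormApprox A φ u ∧ FormApprox A ψ v ∧
    Tendsto (fun n => (inner ℂ (u n : H) (A (v n)) : ℂ)) atTop (𝓝 z)

end Form

section Propagator

variable {K : Type*} [NormedAddCommGroup K] [InnerProductSpace ℂ K] [CompleteSpace K]
  {𝓗 : ℝ → Type*} [∀ t, NormedAddCommGroup (𝓗 t)] [∀ t, InnerProductSpace ℂ (𝓗 t)]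
  [∀ t, CompleteSpace (𝓗 t)]

/-- A uniformly semibounded time-dependent Hamiltonian: densely defined self-adjoint operators
`A t`, `t ∈ I`, with a common lower bound. -/
def IsSemiboundedHamiltonian (I : Set ℝ) (A : ∀ t, 𝓗 t →ₗ.[ℂ] 𝓗 t) : Prop :=
  (∀ t ∈ I, Dense ((A t).domain : Set (𝓗 t)) ∧ IsSelfAdjoint (A t)) ∧
    ∃ m : ℝ, ∀ t ∈ I, ∀ ψ : (A t).domain, -m * ‖(ψ : 𝓗 t)‖ ^ 2 ≤ (quadForm (A t) ψ).re

/-- A unitary propagator `U t s : 𝓗 s → 𝓗 t`, `t, s ∈ I`. Joint strong continuity is meant in the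
fixed space `K`, where `U t s` acts as `J t ∘ U t s ∘ (J s)†`. -/
structure IsUnitaryPropagator (I : Set ℝ) (J : ∀ t, 𝓗 t →ₗᵢ[ℂ] K)
    (U : ∀ t s, 𝓗 s →L[ℂ] 𝓗 t) : Prop where
  norm_map : ∀ t ∈ I, ∀ s ∈ I, ∀ ψ, ‖U t s ψ‖ = ‖ψ‖
  surjective : ∀ t ∈ I, ∀ s ∈ I, Function.Surjective (U t s)
  comp : ∀ t ∈ I, ∀ s ∈ I, ∀ r ∈ I, (U t s) ∘L (U s r) = U t r
  continuous : ∀ ψ : K, ContinuousOn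
    (fun p : ℝ × ℝ => J p.1 (U p.1 p.2 ((J p.2).toContinuousLinearMap.adjoint ψ))) (I ×ˢ I)

/-- The unitary propagator `U` is a weak solution of the Schrödinger equation generated by `A`:
every trajectory `Ψ(t) = U t s Ψ₀` starting in the form domain at time `s` stays in the form domain
and satisfies `i (d/dr) ⟨Φ, Ψ(r)⟩ = h_t(Φ, Ψ(t))` at `r = t`, for every `t ∈ I` and every `Φ` in the
form domain at time `t` (one-sided derivatives at the end points of `I`). -/
structure IsWeakSolution (I : Set ℝ) (J : ∀ t, 𝓗 t →ₗᵢ[ℂ] K) (A : ∀ t, 𝓗 t →ₗ.[ℂ] 𝓗 t)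
    (U : ∀ t s, 𝓗 s →L[ℂ] 𝓗 t) : Prop where
  propagator : IsUnitaryPropagator I J U
  mem_formDomain : ∀ s ∈ I, ∀ Ψ₀ ∈ formDomain (A s), ∀ t ∈ I, U t s Ψ₀ ∈ formDomain (A t)
  initial : ∀ s ∈ I, ∀ Ψ₀ ∈ formDomain (A s), U s s Ψ₀ = Ψ₀
  weak : ∀ s ∈ I, ∀ Ψ₀ ∈ formDomain (A s), ∀ t ∈ I, ∀ Φ ∈ formDomain (A t), ∃ v : ℂ,
    HasDerivWithinAt (fun r => (inner ℂ (J t Φ) (J r (U r s Ψ₀)) : ℂ)) v I t ∧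
      IsFormValue (A t) Φ (U t s Ψ₀) (Complex.I * v)

end Propagator

/-! ### The box and its `L²` space -/

/-- The box `Ω_{ℓ,d}`. -/
def box (ℓ d : ℝ) : Set ℝ := Icc (d - ℓ / 2) (d + ℓ / 2)

/-- Lebesgue measure on `Ω_{ℓ,d}`. -/
abbrev boxMeasure (ℓ d : ℝ) : Measure ℝ := volume.restrict (box ℓ d)

/-- `L²(Ω_{ℓ,d})`, complex valued. -/
abbrev L2 (ℓ d : ℝ) : Type := Lp ℂ 2 (boxMeasure ℓ d)

/-- `L²(ℝ)`, complex valued. -/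
abbrev L2R : Type := Lp ℂ 2 (volume : Measure ℝ)

theorem measurableSet_box (ℓ d : ℝ) : MeasurableSet (box ℓ d) := measurableSet_Icc

instance isFiniteMeasure_box (ℓ d : ℝ) : IsFiniteMeasure (boxMeasure ℓ d) := by
  unfold boxMeasure box
  infer_instance

theorem memLp_extend {ℓ d : ℝ} (f : L2 ℓ d) :
    MemLp ((box ℓ d).indicator (f : ℝ → ℂ)) 2 volume :=
  (memLp_indicator_iff_restrict (measurableSet_box ℓ d)).2 (Lp.memLp f)

/-- Extension by zero, `L²(Ω_{ℓ,d}) → L²(ℝ)`. -/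
def extend (ℓ d : ℝ) : L2 ℓ d →ₗᵢ[ℂ] L2R where
  toFun f := (memLp_extend f).toLp _
  map_add' f g := by
    rw [← MemLp.toLp_add, MemLp.toLp_eq_toLp_iff, ← Set.indicator_add']
    exact (ae_eq_restrict_iff_indicator_ae_eq (measurableSet_box ℓ d)).1 (Lp.coeFn_add f g)
  map_smul' c f := by
    rw [RingHom.id_apply, ← MemLp.toLp_const_smul, MemLp.toLp_eq_toLp_iff]
    refine ((ae_eq_restrict_iff_indicator_ae_eq (measurableSet_box ℓ d)).1
      (Lp.coeFn_smul c f)).trans (Eventually.of_forall fun x => ?_)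
    by_cases hx : x ∈ box ℓ d <;> simp [hx]
  norm_map' f := by
    simp only [LinearMap.coe_mk, AddHom.coe_mk]
    rw [Lp.norm_toLp, eLpNorm_indicator_eq_eLpNorm_restrict (measurableSet_box ℓ d), Lp.norm_def]

/-! ### The dilation-translation `W_{ℓ,d}` -/

theorem map_affine_boxMeasure {ℓ : ℝ} (d : ℝ) (hℓ : 0 < ℓ) :
    (boxMeasure 1 0).map (fun x => ℓ * x + d) = ENNReal.ofReal ℓ⁻¹ • boxMeasure ℓ d := by
  have hm : Measurable fun x : ℝ => ℓ * x + d := by fun_prop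
  have hpre : (fun x : ℝ => ℓ * x + d) ⁻¹' box ℓ d = box 1 0 := by
    ext x
    simp only [box, mem_preimage, mem_Icc]
    constructor
    · rintro ⟨h1, h2⟩
      constructor <;> nlinarith
    · rintro ⟨h1, h2⟩
      constructor <;> nlinarith
  have hmap : (volume : Measure ℝ).map (fun x => ℓ * x + d) = ENNReal.ofReal ℓ⁻¹ • volume := by
    have h1 : (fun x : ℝ => ℓ * x + d) = (fun x => x + d) ∘ fun x => ℓ * x := rfl
    rw [h1, ← Measure.map_map (by fun_prop) (by fun_prop), Real.map_volume_mul_left hℓ.ne',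
      Measure.map_smul, map_add_right_eq_self, abs_of_pos (inv_pos.2 hℓ)]
  rw [boxMeasure, ← hpre, ← Measure.restrict_map hm (measurableSet_box ℓ d), hmap, Measure.restrict_smul]

theorem eLpNorm_dilation {ℓ d : ℝ} (hℓ : 0 < ℓ) (f : L2 ℓ d) :
    eLpNorm (fun x => ((√ℓ : ℝ) : ℂ) * f (ℓ * x + d)) 2 (boxMeasure 1 0) =
      eLpNorm f 2 (boxMeasure ℓ d) := by
  have hm : Measurable fun x : ℝ => ℓ * x + d := by fun_prop
  have hc : ENNReal.ofReal ℓ⁻¹ ≠ 0 := by simpa using hℓ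
  have hf : AEStronglyMeasurable f ((boxMeasure 1 0).map fun x => ℓ * x + d) := by
    rw [map_affine_boxMeasure d hℓ]
    exact (Lp.aestronglyMeasurable f).smul_measure _
  have h1 : (fun x => ((√ℓ : ℝ) : ℂ) * f (ℓ * x + d)) =
      ((√ℓ : ℝ) : ℂ) • (f ∘ fun x => ℓ * x + d) := rfl
  rw [h1, eLpNorm_const_smul, ← eLpNorm_map_measure hf hm.aemeasurable,
    map_affine_boxMeasure d hℓ, eLpNorm_smul_measure_of_ne_zero hc, smul_eq_mul, ← mul_assoc]
  have h2 : ‖((√ℓ : ℝ) : ℂ)‖ₑ = ENNReal.ofReal (√ℓ) := by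
    rw [← ofReal_norm, Complex.norm_real, Real.norm_of_nonneg (Real.sqrt_nonneg _)]
  have h3 : ENNReal.ofReal ℓ⁻¹ ^ (1 / (2 : ENNReal)).toReal = ENNReal.ofReal (√ℓ)⁻¹ := by
    rw [ENNReal.ofReal_rpow_of_pos (inv_pos.2 hℓ), ← Real.sqrt_inv, Real.sqrt_eq_rpow]
    norm_num
  rw [h2, h3, ← ENNReal.ofReal_mul (Real.sqrt_nonneg _),
    mul_inv_cancel₀ (Real.sqrt_pos.2 hℓ).ne', ENNReal.ofReal_one, one_mul]

theorem memLp_dilation {ℓ d : ℝ} (f : L2 ℓ d) :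
    MemLp (fun x => ((√ℓ : ℝ) : ℂ) * f (ℓ * x + d)) 2 (boxMeasure 1 0) := by
  rcases le_or_gt ℓ 0 with hℓ | hℓ
  · simp [Real.sqrt_eq_zero_of_nonpos hℓ]
  · refine ⟨?_, by rw [eLpNorm_dilation hℓ]; exact Lp.eLpNorm_lt_top f⟩
    have hm : Measurable fun x : ℝ => ℓ * x + d := by fun_prop
    have hf : AEStronglyMeasurable f ((boxMeasure 1 0).map fun x => ℓ * x + d) := by
      rw [map_affine_boxMeasure d hℓ]
      exact (Lp.aestronglyMeasurable f).smul_measure _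
    exact (hf.comp_measurable hm).const_mul _

theorem dilation_congr {ℓ d : ℝ} {f g : ℝ → ℂ} (h : f =ᵐ[boxMeasure ℓ d] g) :
    (fun x => ((√ℓ : ℝ) : ℂ) * f (ℓ * x + d)) =ᵐ[boxMeasure 1 0]
      fun x => ((√ℓ : ℝ) : ℂ) * g (ℓ * x + d) := by
  rcases le_or_gt ℓ 0 with hℓ | hℓ
  · simp [Real.sqrt_eq_zero_of_nonpos hℓ]
  · have hm : Measurable fun x : ℝ => ℓ * x + d := by fun_prop
    have h' : f =ᵐ[(boxMeasure 1 0).map fun x => ℓ * x + d] g := by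
      rw [map_affine_boxMeasure d hℓ]
      exact Measure.ae_smul_measure h _
    filter_upwards [ae_of_ae_map hm.aemeasurable h'] with x hx
    rw [hx]

/-- `W_{ℓ,d} : L²(Ω_{ℓ,d}) → L²(Ω_{1,0})`, `(W_{ℓ,d} f)(x) = √ℓ f(ℓ x + d)`. -/
def W (ℓ d : ℝ) : L2 ℓ d →L[ℂ] L2 1 0 :=
  LinearMap.mkContinuous
    { toFun := fun f => (memLp_dilation f).toLp _
      map_add' := fun f g => by
        rw [← MemLp.toLp_add, MemLp.toLp_eq_toLp_iff]
        refine (dilation_congr (Lp.coeFn_add f g)).trans (Eventually.of_forall fun x => ?_)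
        simp [mul_add]
      map_smul' := fun c f => by
        rw [RingHom.id_apply, ← MemLp.toLp_const_smul, MemLp.toLp_eq_toLp_iff]
        refine (dilation_congr (Lp.coeFn_smul c f)).trans (Eventually.of_forall fun x => ?_)
        simp [mul_left_comm] } 1
    fun f => by
      simp only [LinearMap.coe_mk, AddHom.coe_mk, one_mul]
      rw [Lp.norm_toLp]
      rcases le_or_gt ℓ 0 with hℓ | hℓ
      · simp [Real.sqrt_eq_zero_of_nonpos hℓ]
      · rw [eLpNorm_dilation hℓ, Lp.norm_def]

/-! ### Sobolev spaces on the box -/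

/-- Test functions: smooth, with compact support in the interior of `Ω_{ℓ,d}`. -/
structure IsTestFunction (ℓ d : ℝ) (η : ℝ → ℂ) : Prop where
  smooth : ContDiff ℝ ∞ η
  compact : HasCompactSupport η
  supp : tsupport η ⊆ interior (box ℓ d)

/-- `g` is the weak derivative of `f` on `Ω_{ℓ,d}`. -/
def HasWeakDeriv {ℓ d : ℝ} (f g : L2 ℓ d) : Prop :=
  ∀ η, IsTestFunction ℓ d η →
    ∫ x in box ℓ d, f x * deriv η x = -∫ x in box ℓ d, g x * η x

theorem integrable_mul {ℓ d : ℝ} (f : L2 ℓ d) {u : ℝ → ℂ} (hu : Continuous u)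
    (hc : HasCompactSupport u) : Integrable (fun x => f x * u x) (boxMeasure ℓ d) := by
  obtain ⟨C, hC⟩ := hc.exists_bound_of_continuous hu
  have hf : Integrable f (boxMeasure ℓ d) := (Lp.memLp f).integrable (by norm_num)
  exact hf.mul_bdd hu.aestronglyMeasurable (Eventually.of_forall hC)

theorem IsTestFunction.integrable {ℓ d : ℝ} {η : ℝ → ℂ} (h : IsTestFunction ℓ d η)
    (f : L2 ℓ d) : Integrable (fun x => f x * η x) (boxMeasure ℓ d) :=
  integrable_mul f h.smooth.continuous h.compact

theorem IsTestFunction.integrable_deriv {ℓ d : ℝ} {η : ℝ → ℂ} (h : IsTestFunction ℓ d η)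
    (f : L2 ℓ d) : Integrable (fun x => f x * deriv η x) (boxMeasure ℓ d) :=
  integrable_mul f (h.smooth.continuous_deriv (by simp)) h.compact.deriv

theorem HasWeakDeriv.add {ℓ d : ℝ} {f g f' g' : L2 ℓ d} (hf : HasWeakDeriv f f')
    (hg : HasWeakDeriv g g') : HasWeakDeriv (f + g) (f' + g') := by
  intro η hη
  have h1 : ∫ x in box ℓ d, (f + g : L2 ℓ d) x * deriv η x =
      ∫ x in box ℓ d, (f x * deriv η x + g x * deriv η x) := by
    refine integral_congr_ae ?_
    filter_upwards [Lp.coeFn_add f g] with x hx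
    rw [hx, Pi.add_apply, add_mul]
  have h2 : ∫ x in box ℓ d, (f' + g' : L2 ℓ d) x * η x =
      ∫ x in box ℓ d, (f' x * η x + g' x * η x) := by
    refine integral_congr_ae ?_
    filter_upwards [Lp.coeFn_add f' g'] with x hx
    rw [hx, Pi.add_apply, add_mul]
  rw [h1, h2, integral_add (hη.integrable_deriv f) (hη.integrable_deriv g),
    integral_add (hη.integrable f') (hη.integrable g'), hf η hη, hg η hη, neg_add]

theorem HasWeakDeriv.smul {ℓ d : ℝ} {f f' : L2 ℓ d} (c : ℂ) (hf : HasWeakDeriv f f') :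
    HasWeakDeriv (c • f) (c • f') := by
  intro η hη
  have h1 : ∫ x in box ℓ d, (c • f : L2 ℓ d) x * deriv η x =
      ∫ x in box ℓ d, c * (f x * deriv η x) := by
    refine integral_congr_ae ?_
    filter_upwards [Lp.coeFn_smul c f] with x hx
    rw [hx, Pi.smul_apply, smul_eq_mul, mul_assoc]
  have h2 : ∫ x in box ℓ d, (c • f' : L2 ℓ d) x * η x =
      ∫ x in box ℓ d, c * (f' x * η x) := by
    refine integral_congr_ae ?_
    filter_upwards [Lp.coeFn_smul c f'] with x hx
    rw [hx, Pi.smul_apply, smul_eq_mul, mul_assoc]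
  rw [h1, h2, integral_const_mul, integral_const_mul, hf η hη, mul_neg]

theorem HasWeakDeriv.zero (ℓ d : ℝ) : HasWeakDeriv (0 : L2 ℓ d) 0 := by
  intro η _
  have h (u : ℝ → ℂ) : ∫ x in box ℓ d, (0 : L2 ℓ d) x * u x = 0 := by
    refine integral_eq_zero_of_ae ?_
    filter_upwards [Lp.coeFn_zero ℂ 2 (boxMeasure ℓ d)] with x hx
    rw [hx]
    simp
  rw [h, h, neg_zero]

theorem HasWeakDeriv.unique {ℓ d : ℝ} {f g g' : L2 ℓ d} (h : HasWeakDeriv f g)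
    (h' : HasWeakDeriv f g') : g = g' := by
  have hloc : LocallyIntegrableOn (fun x => g x - g' x) (interior (box ℓ d)) volume := by
    have hi (u : L2 ℓ d) : IntegrableOn u (box ℓ d) volume :=
      (Lp.memLp u).integrable (by norm_num)
    exact (((hi g).sub (hi g')).mono_set interior_subset).locallyIntegrableOn
  have key := isOpen_interior.ae_eq_zero_of_integral_contDiff_smul_eq_zero hloc ?_
  · have hbox : boxMeasure ℓ d = volume.restrict (interior (box ℓ d)) := by
      unfold boxMeasure box
      rw [interior_Icc]
      exact Measure.restrict_congr_set Ioo_ae_eq_Icc.symm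
    refine Lp.ext ?_
    have : ∀ᵐ x ∂(volume.restrict (interior (box ℓ d))), g x - g' x = 0 :=
      (ae_restrict_iff' isOpen_interior.measurableSet).2 key
    rw [← hbox] at this
    filter_upwards [this] with x hx
    exact sub_eq_zero.1 hx
  · intro u hu hcu hsu
    have hsub : tsupport (fun x => (u x : ℂ)) ⊆ tsupport u :=
      closure_mono fun x hx => by
        simp only [Function.mem_support] at hx ⊢
        exact fun h0 => hx (by simp [h0])
    have hη : IsTestFunction ℓ d fun x => (u x : ℂ) :=
      { smooth := Complex.ofRealCLM.contDiff.comp hu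
        compact := hcu.comp_left (g := fun r : ℝ => (r : ℂ)) Complex.ofReal_zero
        supp := hsub.trans hsu }
    have e : ∫ x in box ℓ d, g x * (u x : ℂ) = ∫ x in box ℓ d, g' x * (u x : ℂ) :=
      neg_injective ((h _ hη).symm.trans (h' _ hη))
    have e2 : ∫ x in box ℓ d, u x • (g x - g' x) = 0 := by
      have : (fun x => u x • (g x - g' x)) = fun x => g x * (u x : ℂ) - g' x * (u x : ℂ) := by
        ext x
        rw [Complex.real_smul]
        ring
      rw [this, integral_sub (hη.integrable g) (hη.integrable g'), e, sub_self]
    rw [← e2]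
    refine (setIntegral_eq_integral_of_forall_compl_eq_zero fun x hx => ?_).symm
    have : u x = 0 := by
      by_contra h0
      exact hx (interior_subset (hsu (subset_tsupport u h0)))
    simp [this]

/-- The Sobolev space `H¹(Ω_{ℓ,d})`. -/
def H1 (ℓ d : ℝ) : Submodule ℂ (L2 ℓ d) where
  carrier := {f | ∃ g, HasWeakDeriv f g}
  add_mem' := by
    rintro f g ⟨f', hf⟩ ⟨g', hg⟩
    exact ⟨_, hf.add hg⟩
  zero_mem' := ⟨0, HasWeakDeriv.zero ℓ d⟩
  smul_mem' := by
    rintro c f ⟨f', hf⟩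
    exact ⟨_, hf.smul c⟩

/-- The weak derivative `H¹(Ω_{ℓ,d}) → L²(Ω_{ℓ,d})`. -/
def weakDeriv (ℓ d : ℝ) : H1 ℓ d →ₗ[ℂ] L2 ℓ d where
  toFun f := f.2.choose
  map_add' f g := (f + g).2.choose_spec.unique (f.2.choose_spec.add g.2.choose_spec)
  map_smul' c f := (c • f).2.choose_spec.unique (f.2.choose_spec.smul c)

theorem hasWeakDeriv_weakDeriv {ℓ d : ℝ} (f : H1 ℓ d) :
    HasWeakDeriv (f : L2 ℓ d) (weakDeriv ℓ d f) := f.2.choose_spec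

/-- The Sobolev space `H²(Ω_{ℓ,d})`. -/
def H2 (ℓ d : ℝ) : Submodule ℂ (L2 ℓ d) :=
  ((H1 ℓ d).comap (weakDeriv ℓ d)).map (H1 ℓ d).subtype

/-- The pairs `(η, η')`, with `η` a test function, in `L² × L²`. -/
def testGraph (ℓ d : ℝ) : Submodule ℂ (L2 ℓ d × L2 ℓ d) where
  carrier := {p | ∃ η, IsTestFunction ℓ d η ∧ p.1 =ᵐ[boxMeasure ℓ d] η ∧
    p.2 =ᵐ[boxMeasure ℓ d] deriv η}
  add_mem' := by
    rintro p q ⟨η, hη, h1, h2⟩ ⟨θ, hθ, h3, h4⟩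
    refine ⟨η + θ, ⟨hη.smooth.add hθ.smooth, hη.compact.add hθ.compact,
      (tsupport_add η θ).trans (union_subset hη.supp hθ.supp)⟩,
      (Lp.coeFn_add _ _).trans (h1.add h3), (Lp.coeFn_add _ _).trans ((h2.add h4).trans ?_)⟩
    refine Eventually.of_forall fun x => ?_
    exact (deriv_add (hη.smooth.differentiable (by simp) x)
      (hθ.smooth.differentiable (by simp) x)).symm
  zero_mem' := by
    refine ⟨0, ⟨contDiff_const, HasCompactSupport.zero, by simp [tsupport]⟩, Lp.coeFn_zero _ _ _,
      (Lp.coeFn_zero _ _ _).trans (Eventually.of_forall fun x => ?_)⟩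
    exact (deriv_const x (0 : ℂ)).symm
  smul_mem' := by
    rintro c p ⟨η, hη, h1, h2⟩
    have hs : tsupport (c • η) ⊆ tsupport η := closure_mono (Function.support_const_smul_subset c η)
    refine ⟨c • η, ⟨contDiff_const.smul hη.smooth,
      hη.compact.mono' ((Function.support_const_smul_subset c η).trans (subset_tsupport η)),
      hs.trans hη.supp⟩,
      (Lp.coeFn_smul _ _).trans (h1.const_smul c),
      (Lp.coeFn_smul _ _).trans ((h2.const_smul c).trans ?_)⟩
    refine Eventually.of_forall fun x => ?_
    exact (deriv_const_smul c (hη.smooth.differentiable (by simp) x)).symm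

/-- The Sobolev space `H¹₀(Ω_{ℓ,d})`: the closure of the test functions in the `H¹` norm. -/
def H10 (ℓ d : ℝ) : Submodule ℂ (L2 ℓ d) :=
  ((testGraph ℓ d).topologicalClosure.comap
    ((H1 ℓ d).subtype.prod (weakDeriv ℓ d))).map (H1 ℓ d).subtype

/-! ### The Hamiltonians -/

/-- The domain `𝒟_Dir(Ω_{ℓ,d}) = H¹₀ ∩ H²`. -/
def dirDomain (ℓ d : ℝ) : Submodule ℂ (L2 ℓ d) := H10 ℓ d ⊓ H2 ℓ d

theorem dirDomain_le_H1 (ℓ d : ℝ) : dirDomain ℓ d ≤ H1 ℓ d := by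
  rintro f ⟨-, g, -, rfl⟩
  exact g.2

theorem weakDeriv_mem_H1 {ℓ d : ℝ} (f : dirDomain ℓ d) :
    weakDeriv ℓ d (Submodule.inclusion (dirDomain_le_H1 ℓ d) f) ∈ H1 ℓ d := by
  obtain ⟨f, -, g, hg, rfl⟩ := f
  exact hg

/-- `ψ ↦ ψ'` from `𝒟_Dir` to `H¹`. -/
def dirDeriv (ℓ d : ℝ) : dirDomain ℓ d →ₗ[ℂ] H1 ℓ d :=
  LinearMap.codRestrict (H1 ℓ d)
    (weakDeriv ℓ d ∘ₗ Submodule.inclusion (dirDomain_le_H1 ℓ d)) weakDeriv_mem_H1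

/-- The action `ψ ↦ -ψ''` of the nonnegative Dirichlet Laplacian. -/
def dirLaplacian (ℓ d : ℝ) : dirDomain ℓ d →ₗ[ℂ] L2 ℓ d :=
  -(weakDeriv ℓ d ∘ₗ dirDeriv ℓ d)

/-- The Hamiltonian `H_{ℓ,d} = -d²/dx²` of the particle in the box `Ω_{ℓ,d}`, with domain
`H¹₀ ∩ H²`. -/
def boxHamiltonian (ℓ d : ℝ) : L2 ℓ d →ₗ.[ℂ] L2 ℓ d where
  domain := dirDomain ℓ d
  toFun := dirLaplacian ℓ d

theorem memLp_mulX {ℓ d : ℝ} (f : L2 ℓ d) :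
    MemLp (fun x : ℝ => (x : ℂ) * f x) 2 (boxMeasure ℓ d) := by
  refine (Lp.memLp f).of_le_mul (c := |d - ℓ / 2| + |d + ℓ / 2|)
    (Complex.continuous_ofReal.aestronglyMeasurable.mul (Lp.aestronglyMeasurable f)) ?_
  filter_upwards [ae_restrict_mem (measurableSet_box ℓ d)] with x hx
  rw [norm_mul, Complex.norm_real, Real.norm_eq_abs]
  refine mul_le_mul_of_nonneg_right ?_ (norm_nonneg _)
  have h1 := neg_abs_le (d - ℓ / 2)
  have h2 := le_abs_self (d + ℓ / 2)
  have h3 := abs_nonneg (d - ℓ / 2)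
  have h4 := abs_nonneg (d + ℓ / 2)
  exact abs_le.2 ⟨by linarith [hx.1], by linarith [hx.2]⟩

/-- The position operator, `(x ψ)(x) = x ψ(x)`. -/
def mulX (ℓ d : ℝ) : L2 ℓ d →ₗ[ℂ] L2 ℓ d where
  toFun f := (memLp_mulX f).toLp _
  map_add' f g := by
    rw [← MemLp.toLp_add, MemLp.toLp_eq_toLp_iff]
    filter_upwards [Lp.coeFn_add f g] with x hx
    rw [hx, Pi.add_apply, mul_add]
    rfl
  map_smul' c f := by
    rw [RingHom.id_apply, ← MemLp.toLp_const_smul, MemLp.toLp_eq_toLp_iff]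
    filter_upwards [Lp.coeFn_smul c f] with x hx
    rw [hx, Pi.smul_apply, Pi.smul_apply, smul_eq_mul, smul_eq_mul, mul_left_comm]

theorem HasWeakDeriv.mulX {ℓ d : ℝ} {f f' : L2 ℓ d} (hf : HasWeakDeriv f f') :
    HasWeakDeriv (mulX ℓ d f) (f + MovingBox.mulX ℓ d f') := by
  intro η hη
  have hd (x : ℝ) : HasDerivAt (fun y : ℝ => (y : ℂ) * η y) (η x + x * deriv η x) x := by
    have h := HasDerivAt.fun_mul (Complex.ofRealCLM.hasDerivAt (x := x))
      (hη.smooth.differentiable (by simp) x).hasDerivAt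
    simpa using h
  have hs : Function.support (fun y : ℝ => (y : ℂ) * η y) ⊆ Function.support η :=
    Function.support_mul_subset_right _ _
  have hθ : IsTestFunction ℓ d fun y : ℝ => (y : ℂ) * η y :=
    { smooth := Complex.ofRealCLM.contDiff.mul hη.smooth
      compact := hη.compact.mono hs
      supp := (closure_mono hs).trans hη.supp }
  have e := hf _ hθ
  have e1 : ∫ x in box ℓ d, f x * deriv (fun y : ℝ => (y : ℂ) * η y) x =
      ∫ x in box ℓ d, (f x * η x + MovingBox.mulX ℓ d f x * deriv η x) := by
    refine integral_congr_ae ?_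
    filter_upwards [(memLp_mulX f).coeFn_toLp] with x hx
    change _ = _ + ((memLp_mulX f).toLp _ : L2 ℓ d) x * _
    rw [(hd x).deriv, hx]
    ring
  have e2 : ∫ x in box ℓ d, f' x * ((x : ℂ) * η x) =
      ∫ x in box ℓ d, MovingBox.mulX ℓ d f' x * η x := by
    refine integral_congr_ae ?_
    filter_upwards [(memLp_mulX f').coeFn_toLp] with x hx
    change _ = ((memLp_mulX f').toLp _ : L2 ℓ d) x * _
    rw [hx]
    ring
  have e3 : ∫ x in box ℓ d, (f + MovingBox.mulX ℓ d f' : L2 ℓ d) x * η x =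
      ∫ x in box ℓ d, (f x * η x + MovingBox.mulX ℓ d f' x * η x) := by
    refine integral_congr_ae ?_
    filter_upwards [Lp.coeFn_add f (MovingBox.mulX ℓ d f')] with x hx
    rw [hx, Pi.add_apply, add_mul]
  rw [e1, e2, integral_add (hη.integrable f) (hη.integrable_deriv _)] at e
  rw [e3, integral_add (hη.integrable f) (hη.integrable _)]
  linear_combination e

theorem mulX_mem_H1 {ℓ d : ℝ} (f : H1 ℓ d) : mulX ℓ d f ∈ H1 ℓ d :=
  ⟨_, (hasWeakDeriv_weakDeriv f).mulX⟩

/-- The position operator on `H¹`. -/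
def mulX1 (ℓ d : ℝ) : H1 ℓ d →ₗ[ℂ] H1 ℓ d :=
  LinearMap.codRestrict (H1 ℓ d) (mulX ℓ d ∘ₗ (H1 ℓ d).subtype) mulX_mem_H1

/-- The momentum operator `p ψ = -i ψ'`. -/
def momentum (ℓ d : ℝ) : H1 ℓ d →ₗ[ℂ] L2 ℓ d := (-Complex.I) • weakDeriv ℓ d

/-- The operator `x ∘ p = (x p + p x) / 2`. -/
def xp (ℓ d : ℝ) : H1 ℓ d →ₗ[ℂ] L2 ℓ d :=
  (1 / 2 : ℂ) • (mulX ℓ d ∘ₗ momentum ℓ d + momentum ℓ d ∘ₗ mulX1 ℓ d)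

/-- The auxiliary Hamiltonian `ℓ⁻² Δ_Dir - (ℓ'/ℓ) x ∘ p - (d'/ℓ) p` on the unit interval
`Ω_{1,0}`, with domain `H¹₀ ∩ H²`. -/
def auxHamiltonian (ℓ ℓ' d' : ℝ) : L2 1 0 →ₗ.[ℂ] L2 1 0 where
  domain := dirDomain 1 0
  toFun := ((1 / ℓ ^ 2 : ℝ) : ℂ) • dirLaplacian 1 0
    - (((ℓ' / ℓ : ℝ) : ℂ) • xp 1 0 + ((d' / ℓ : ℝ) : ℂ) • momentum 1 0) ∘ₗ
        Submodule.inclusion (dirDomain_le_H1 1 0)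

end MovingBox

end

namespace MovingBox

/-! ### Weak derivatives, the closure of the test functions, and integration by parts -/

section WeakDerivative

variable {ℓ d : ℝ}

/-! Write `W(t)` for `W_{ℓ(t),d(t)}`, let `Φ` be in the form domain at time `t`, and put `χ(r) =
Ũ(r,s) W(s) Ψ₀`. After extension by zero, `⟨Φ, Ψ(r)⟩ = ⟨W(r) Φ, χ(r)⟩`, a scalar product on the
fixed unit box in which both factors move (`inner_extend_adjoint_W`).

The factor `W(r) Φ` is norm differentiable at `r = t`, because `Φ` is an `H¹` limit of test
functions (`hasDerivWithinAt_pullback_extend`). Its derivative is `D W(t) Φ` with `D = (ℓ'/ℓ)(1/2 +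
x ∂) + (d'/ℓ) ∂`, the operator `dilationGen`. The factor `χ` is continuous and weakly differentiable
when tested against `W(t) Φ`, which is enough for a product rule (`hasDerivWithinAt_inner_of_weak`).

Since `x ∘ p = -i (1/2 + x ∂)`, the auxiliary form is `ℓ⁻² ⟨φ', ψ'⟩ + i ⟨φ, D ψ⟩`. Multiplied by
`i`, the product rule therefore gives `i ⟨D W Φ, χ⟩ + ℓ⁻² ⟨(W Φ)', χ'⟩ + i ⟨W Φ, D χ⟩`. The operator
`D` is antisymmetric on `H¹₀` (`inner_dilationGen`), so the first-order terms cancel. The remaining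
term is `⟨Φ', Ψ(t)'⟩`, because `W` multiplies derivatives by `ℓ`.

Two facts make this meaningful. The first-order terms are absorbed by the Laplacian, so form
approximation is `H¹` approximation for both Hamiltonians (`IsPerturbedLaplacian.formApprox_iff`);
and `W` and `W†` respect such approximations (`IsScaling.graphApprox`). Self-adjointness of the
Dirichlet Laplacian follows from surjectivity of `-∂² + 1`, obtained by orthogonal projection in `L²
⊕ L²`. The propagator is jointly continuous since it factors into strongly continuous contractions.
-/

theorem IsTestFunction.star {η : ℝ → ℂ} (h : IsTestFunction ℓ d η) :
    IsTestFunction ℓ d fun x => Star.star (η x) := by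
  have hs : Function.support (fun x => Star.star (η x)) = Function.support η := by
    ext x; simp
  refine ⟨?_, ?_, ?_⟩
  · exact (starL' ℝ (A := ℂ)).contDiff.comp h.smooth
  · exact h.compact.mono hs.le
  · rw [tsupport, hs]; exact h.supp

theorem IsTestFunction.deriv_star {η : ℝ → ℂ} (h : IsTestFunction ℓ d η) (x : ℝ) :
    deriv (fun x => Star.star (η x)) x = Star.star (deriv η x) :=
  ((h.smooth.differentiable (by simp) x).hasDerivAt.star).deriv

theorem IsTestFunction.memLp {η : ℝ → ℂ} (h : IsTestFunction ℓ d η) (μ : Measure ℝ)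
    [IsFiniteMeasureOnCompacts μ] : MemLp η 2 μ :=
  h.smooth.continuous.memLp_of_hasCompactSupport h.compact

theorem IsTestFunction.memLp_deriv {η : ℝ → ℂ} (h : IsTestFunction ℓ d η) (μ : Measure ℝ)
    [IsFiniteMeasureOnCompacts μ] : MemLp (deriv η) 2 μ :=
  (h.smooth.continuous_deriv (by simp)).memLp_of_hasCompactSupport h.compact.deriv

theorem IsTestFunction.toLp_mem_testGraph {η : ℝ → ℂ} (h : IsTestFunction ℓ d η) :
    (MemLp.toLp η (h.memLp (boxMeasure ℓ d)), MemLp.toLp (deriv η) (h.memLp_deriv (boxMeasure ℓ d))) ∈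
      testGraph ℓ d :=
  ⟨η, h, MemLp.coeFn_toLp (h.memLp _), MemLp.coeFn_toLp (h.memLp_deriv _)⟩

theorem inner_eq_integral_of_ae_eq {f g : L2 ℓ d} {u : ℝ → ℂ} (h : f =ᵐ[boxMeasure ℓ d] u) :
    inner ℂ f g = ∫ x in box ℓ d, g x * star (u x) := by
  rw [L2.inner_def]
  refine integral_congr_ae ?_
  filter_upwards [h] with x hx
  rw [hx, RCLike.inner_apply]
  rfl

/-- Weak differentiability, expressed by scalar products with test functions. -/
theorem hasWeakDeriv_iff {f g : L2 ℓ d} :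
    HasWeakDeriv f g ↔ ∀ p ∈ testGraph ℓ d, (inner ℂ p.2 f : ℂ) = -inner ℂ p.1 g := by
  constructor
  · rintro h p ⟨η, hη, h1, h2⟩
    rw [inner_eq_integral_of_ae_eq h1, inner_eq_integral_of_ae_eq h2, ← h _ hη.star]
    simp_rw [hη.deriv_star]
  · intro h η hη
    have := h _ hη.star.toLp_mem_testGraph
    rw [inner_eq_integral_of_ae_eq (MemLp.coeFn_toLp _),
      inner_eq_integral_of_ae_eq (MemLp.coeFn_toLp _)] at this
    simpa only [hη.deriv_star, star_star] using this

theorem hasWeakDeriv_of_mem_testGraph {p : L2 ℓ d × L2 ℓ d} (hp : p ∈ testGraph ℓ d) :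
    HasWeakDeriv p.1 p.2 := by
  obtain ⟨η, hη, h1, h2⟩ := hp
  intro θ hθ
  -- A test function vanishes off the box, so both integrals may be taken over `ℝ`, where
  -- integration by parts has no boundary terms.
  have e1 : ∫ x in box ℓ d, p.1 x * deriv θ x = ∫ x, η x * deriv θ x := by
    rw [← setIntegral_eq_integral_of_forall_compl_eq_zero (s := box ℓ d)
      (f := fun x => η x * deriv θ x)]
    · refine integral_congr_ae ?_
      filter_upwards [h1] with x hx
      rw [hx]
    · intro x hx
      have : η x = 0 := by
        by_contra h0
        exact hx (interior_subset (hη.supp (subset_tsupport η h0)))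
      simp [this]
  have e2 : ∫ x in box ℓ d, p.2 x * θ x = ∫ x, deriv η x * θ x := by
    rw [← setIntegral_eq_integral_of_forall_compl_eq_zero (s := box ℓ d)
      (f := fun x => deriv η x * θ x)]
    · refine integral_congr_ae ?_
      filter_upwards [h2] with x hx
      rw [hx]
    · intro x hx
      have : θ x = 0 := by
        by_contra h0
        exact hx (interior_subset (hθ.supp (subset_tsupport θ h0)))
      simp [this]
  rw [e1, e2]
  have cη := hη.smooth.continuous
  have cθ := hθ.smooth.continuous
  have cη' : Continuous (deriv η) := hη.smooth.continuous_deriv (by simp)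
  have cθ' : Continuous (deriv θ) := hθ.smooth.continuous_deriv (by simp)
  refine integral_mul_deriv_eq_deriv_mul_of_integrable
    (fun x _ => (hη.smooth.differentiable (by simp) x).hasDerivAt)
    (fun x _ => (hθ.smooth.differentiable (by simp) x).hasDerivAt) ?_ ?_ ?_
  · exact (cη.mul cθ').integrable_of_hasCompactSupport hη.compact.mul_right
  · exact (cη'.mul cθ).integrable_of_hasCompactSupport hθ.compact.mul_left
  · exact (cη.mul cθ).integrable_of_hasCompactSupport hη.compact.mul_right

/-- For each fixed test pair the defining identity is a closed condition on the pair, so it survives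
`L² × L²` limits. -/
theorem hasWeakDeriv_of_mem_closure {p : L2 ℓ d × L2 ℓ d}
    (hp : p ∈ (testGraph ℓ d).topologicalClosure) : HasWeakDeriv p.1 p.2 := by
  rw [hasWeakDeriv_iff]
  intro q hq
  have hc : IsClosed {p : L2 ℓ d × L2 ℓ d | (inner ℂ q.2 p.1 : ℂ) = -inner ℂ q.1 p.2} :=
    isClosed_eq (by fun_prop) (by fun_prop)
  exact closure_minimal (fun p hp => hasWeakDeriv_iff.1 (hasWeakDeriv_of_mem_testGraph hp) q hq)
    hc hp

/-- Integration by parts: `⟨φ', f⟩ = -⟨φ, f'⟩` for `φ ∈ H¹₀`, `f ∈ H¹`. -/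
theorem HasWeakDeriv.inner_eq {f g : L2 ℓ d} (h : HasWeakDeriv f g) {p : L2 ℓ d × L2 ℓ d}
    (hp : p ∈ (testGraph ℓ d).topologicalClosure) : (inner ℂ p.2 f : ℂ) = -inner ℂ p.1 g := by
  have hc : IsClosed {p : L2 ℓ d × L2 ℓ d | (inner ℂ p.2 f : ℂ) = -inner ℂ p.1 g} :=
    isClosed_eq (by fun_prop) (by fun_prop)
  exact closure_minimal (fun p hp => hasWeakDeriv_iff.1 h p hp) hc hp

theorem weakDeriv_eq {f : H1 ℓ d} {g : L2 ℓ d} (h : HasWeakDeriv (f : L2 ℓ d) g) :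
    weakDeriv ℓ d f = g :=
  (hasWeakDeriv_weakDeriv f).unique h

/-- The derivative on the domain of the Dirichlet Laplacian. -/
noncomputable def domDeriv (ℓ d : ℝ) : dirDomain ℓ d →ₗ[ℂ] L2 ℓ d :=
  weakDeriv ℓ d ∘ₗ Submodule.inclusion (dirDomain_le_H1 ℓ d)

theorem hasWeakDeriv_domDeriv (u : dirDomain ℓ d) : HasWeakDeriv (u : L2 ℓ d) (domDeriv ℓ d u) :=
  hasWeakDeriv_weakDeriv (Submodule.inclusion (dirDomain_le_H1 ℓ d) u)

theorem domDeriv_mem_closure (u : dirDomain ℓ d) :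
    ((u : L2 ℓ d), domDeriv ℓ d u) ∈ (testGraph ℓ d).topologicalClosure := by
  obtain ⟨u, ⟨v, hv, rfl⟩, h2⟩ := u
  exact hv

theorem hasWeakDeriv_dirLaplacian (u : dirDomain ℓ d) :
    HasWeakDeriv (domDeriv ℓ d u) (-dirLaplacian ℓ d u) := by
  have : -dirLaplacian ℓ d u = weakDeriv ℓ d (dirDeriv ℓ d u) := by simp [dirLaplacian]
  rw [this]
  exact hasWeakDeriv_weakDeriv (dirDeriv ℓ d u)

/-- The practical entrance to `𝒟_Dir`: explicit derivatives suffice, since uniqueness identifies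
them with the chosen `weakDeriv`. -/
theorem mem_dirDomain_of_closure {f g h : L2 ℓ d}
    (hfg : (f, g) ∈ (testGraph ℓ d).topologicalClosure) (hgh : HasWeakDeriv g h) :
    f ∈ dirDomain ℓ d := by
  have hf : HasWeakDeriv f g := hasWeakDeriv_of_mem_closure hfg
  have e : weakDeriv ℓ d ⟨f, g, hf⟩ = g := weakDeriv_eq hf
  refine ⟨⟨⟨f, g, hf⟩, ?_, rfl⟩, ⟨⟨f, g, hf⟩, ?_, rfl⟩⟩
  · change (f, weakDeriv ℓ d ⟨f, g, hf⟩) ∈ (testGraph ℓ d).topologicalClosure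
    rw [e]
    exact hfg
  · change weakDeriv ℓ d ⟨f, g, hf⟩ ∈ H1 ℓ d
    rw [e]
    exact ⟨h, hgh⟩

theorem domDeriv_eq {u : dirDomain ℓ d} {g : L2 ℓ d} (h : HasWeakDeriv (u : L2 ℓ d) g) :
    domDeriv ℓ d u = g :=
  (hasWeakDeriv_domDeriv u).unique h

theorem inner_dirLaplacian {p : L2 ℓ d × L2 ℓ d} (hp : p ∈ (testGraph ℓ d).topologicalClosure)
    (v : dirDomain ℓ d) :
    (inner ℂ p.1 (dirLaplacian ℓ d v) : ℂ) = inner ℂ p.2 (domDeriv ℓ d v) := by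
  rw [(hasWeakDeriv_dirLaplacian v).inner_eq hp, inner_neg_right, neg_neg]

theorem inner_dirLaplacian_dom (u v : dirDomain ℓ d) :
    (inner ℂ (u : L2 ℓ d) (dirLaplacian ℓ d v) : ℂ) = inner ℂ (domDeriv ℓ d u) (domDeriv ℓ d v) :=
  inner_dirLaplacian (domDeriv_mem_closure u) v

end WeakDerivative

/-! ### Self-adjointness of the Dirichlet Laplacian -/

section SelfAdjoint

/-- A symmetric nonnegative operator `A` such that `A + 1` is surjective is densely defined. -/
theorem dense_domain_of_surjective_add_one {H : Type*} [NormedAddCommGroup H]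
    [InnerProductSpace ℂ H] [CompleteSpace H] {A : H →ₗ.[ℂ] H}
    (hnn : ∀ u : A.domain, 0 ≤ (inner ℂ (u : H) (A u)).re)
    (hsurj : ∀ f, ∃ u : A.domain, A u + u = f) : Dense (A.domain : Set H) := by
  rw [Submodule.dense_iff_topologicalClosure_eq_top, Submodule.topologicalClosure_eq_top_iff,
    Submodule.eq_bot_iff]
  intro v hv
  -- Pairing `v = A u + u` with `u` gives `⟨u, A u⟩ + ‖u‖² = 0`, and nonnegativity forces `u = 0`.
  obtain ⟨u, rfl⟩ := hsurj v
  have h0 : (inner ℂ (u : H) (A u + u) : ℂ) = 0 := hv u u.2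
  rw [inner_add_right, inner_self_eq_norm_sq_to_K] at h0
  have h1 := congrArg Complex.re h0
  have h2 : (((‖(u : H)‖ : ℂ)) ^ 2).re = ‖(u : H)‖ ^ 2 := by norm_cast
  have h3 := hnn u
  simp only [Complex.add_re, Complex.zero_re, Complex.coe_algebraMap] at h1
  rw [h2] at h1
  have h4 : (u : H) = 0 := by
    rw [← norm_eq_zero]
    nlinarith [sq_nonneg ‖(u : H)‖]
  have h5 : u = 0 := Subtype.ext h4
  simp [h5]

/-- A symmetric densely defined operator `A` such that `A + 1` is surjective is self-adjoint. -/
theorem isSelfAdjoint_of_surjective_add_one {H : Type*} [NormedAddCommGroup H]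
    [InnerProductSpace ℂ H] [CompleteSpace H] {A : H →ₗ.[ℂ] H} (hd : Dense (A.domain : Set H))
    (hsymm : ∀ u v : A.domain, (inner ℂ (A u) (v : H) : ℂ) = inner ℂ (u : H) (A v))
    (hsurj : ∀ f, ∃ u : A.domain, A u + u = f) : IsSelfAdjoint A := by
  have hle : A ≤ A.adjoint := LinearPMap.IsFormalAdjoint.le_adjoint hd hsymm
  rw [LinearPMap.isSelfAdjoint_def]
  refine (LinearPMap.eq_of_le_of_domain_eq hle (le_antisymm hle.1 fun v hv => ?_)).symm
  -- With `(A + 1) u = (A† + 1) v`, the difference `v - u` lies in the kernel of `A† + 1`, hence is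
  -- orthogonal to the range of `A + 1`, which is everything.
  obtain ⟨u, hu⟩ := hsurj (A.adjoint ⟨v, hv⟩ + v)
  suffices v = u by rw [this]; exact u.2
  rw [← sub_eq_zero, ← inner_self_eq_zero (𝕜 := ℂ)]
  obtain ⟨w, hw⟩ := hsurj (v - u)
  have h1 : (inner ℂ (A.adjoint ⟨v, hv⟩) (w : H) : ℂ) = inner ℂ v (A w) :=
    LinearPMap.adjoint_isFormalAdjoint hd ⟨v, hv⟩ w
  have h2 := hsymm u w
  have h3 := congrArg (fun z => (inner ℂ z (w : H) : ℂ)) hu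
  simp only [inner_add_left] at h3
  nth_rewrite 2 [← hw]
  rw [inner_sub_left, inner_add_right, inner_add_right]
  linear_combination h2 - h1 - h3

/-- Project `(f, 0)` onto the `H¹` closure of the test pairs. The projection is `(u, u')`, and
orthogonality of `(f - u, -u')` to all test pairs says that `u'` has weak derivative `u - f`. The
`WithLp 2` product supplies the Hilbert space structure. -/
theorem surjective_dirLaplacian_add_one (ℓ d : ℝ) (f : L2 ℓ d) :
    ∃ u : dirDomain ℓ d, dirLaplacian ℓ d u + u = f := by
  let e := WithLp.prodContinuousLinearEquiv 2 ℂ (L2 ℓ d) (L2 ℓ d)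
  let G : Submodule ℂ (WithLp 2 (L2 ℓ d × L2 ℓ d)) :=
    (testGraph ℓ d).topologicalClosure.comap (e : _ →L[ℂ] _).toLinearMap
  have hG : IsClosed (G : Set (WithLp 2 (L2 ℓ d × L2 ℓ d))) :=
    (Submodule.isClosed_topologicalClosure _).preimage e.continuous
  have : CompleteSpace G := hG.completeSpace_coe
  obtain ⟨y, hy, z, hz, hyz⟩ := G.exists_add_mem_mem_orthogonal (WithLp.toLp 2 (f, 0))
  have hyc : (y.fst, y.snd) ∈ (testGraph ℓ d).topologicalClosure := hy
  have h1 : f = y.fst + z.fst := congrArg (fun p => p.fst) hyz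
  have h2 : 0 = y.snd + z.snd := congrArg (fun p => p.snd) hyz
  have hw : HasWeakDeriv y.snd (y.fst - f) := by
    rw [hasWeakDeriv_iff]
    intro p hp
    have := hz (WithLp.toLp 2 p) (subset_closure hp)
    rw [WithLp.prod_inner_apply] at this
    change inner ℂ p.1 z.fst + inner ℂ p.2 z.snd = (0 : ℂ) at this
    have e1 : y.snd = -z.snd := eq_neg_of_add_eq_zero_left h2.symm
    rw [e1, h1, sub_add_cancel_left, inner_neg_right, inner_neg_right]
    simp only [neg_neg]
    linear_combination -this
  refine ⟨⟨y.fst, mem_dirDomain_of_closure hyc hw⟩, ?_⟩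
  have e1 := domDeriv_eq (u := ⟨y.fst, mem_dirDomain_of_closure hyc hw⟩)
    (hasWeakDeriv_of_mem_closure hyc)
  have e2 := hasWeakDeriv_dirLaplacian ⟨y.fst, mem_dirDomain_of_closure hyc hw⟩
  rw [e1] at e2
  have e3 := e2.unique hw
  rw [neg_eq_iff_eq_neg] at e3
  rw [e3]
  simp

theorem quadForm_boxHamiltonian (ℓ d : ℝ) (u : (boxHamiltonian ℓ d).domain) :
    quadForm (boxHamiltonian ℓ d) u = ((‖domDeriv ℓ d u‖ ^ 2 : ℝ) : ℂ) := by
  rw [quadForm]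
  refine (inner_dirLaplacian_dom u u).trans ?_
  rw [inner_self_eq_norm_sq_to_K]
  simp

theorem dense_domain_boxHamiltonian (ℓ d : ℝ) :
    Dense ((boxHamiltonian ℓ d).domain : Set (L2 ℓ d)) := by
  refine dense_domain_of_surjective_add_one (fun u => ?_) (surjective_dirLaplacian_add_one ℓ d)
  have := quadForm_boxHamiltonian ℓ d u
  rw [quadForm] at this
  rw [this, Complex.ofReal_re]
  positivity

theorem isSelfAdjoint_boxHamiltonian (ℓ d : ℝ) : IsSelfAdjoint (boxHamiltonian ℓ d) := by
  refine isSelfAdjoint_of_surjective_add_one (dense_domain_boxHamiltonian ℓ d) (fun u v => ?_)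
    (surjective_dirLaplacian_add_one ℓ d)
  refine Eq.trans ?_ (inner_dirLaplacian_dom u v).symm
  rw [← inner_conj_symm]
  refine (congrArg (starRingEnd ℂ) (inner_dirLaplacian_dom v u)).trans ?_
  rw [inner_conj_symm]

end SelfAdjoint

/-! ### Closed forms of first-order perturbations of the Laplacian -/

section FormGraph

variable {ℓ d : ℝ}

/-- An operator on `𝒟_Dir` whose form is that of `-c d²/dx²` minus a first-order perturbation. -/
structure IsPerturbedLaplacian (c : ℝ) (B : L2 ℓ d × L2 ℓ d →L[ℂ] L2 ℓ d)
    (T : dirDomain ℓ d →ₗ[ℂ] L2 ℓ d) : Prop where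
  pos : 0 < c
  inner_eq : ∀ u v : dirDomain ℓ d, (inner ℂ (u : L2 ℓ d) (T v) : ℂ) =
    c * inner ℂ (domDeriv ℓ d u) (domDeriv ℓ d v) - inner ℂ (u : L2 ℓ d) (B (v, domDeriv ℓ d v))

variable {c : ℝ} {B : L2 ℓ d × L2 ℓ d →L[ℂ] L2 ℓ d} {T : dirDomain ℓ d →ₗ[ℂ] L2 ℓ d}

/-- Gårding-type inequality: the form together with the `L²` norm controls the derivative. -/
theorem IsPerturbedLaplacian.norm_domDeriv_sq_le (h : IsPerturbedLaplacian c B T)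
    (w : dirDomain ℓ d) :
    ‖domDeriv ℓ d w‖ ^ 2 ≤ 2 / c * (‖(inner ℂ (w : L2 ℓ d) (T w) : ℂ)‖ + ‖B‖ * ‖(w : L2 ℓ d)‖ ^ 2
      + ‖B‖ ^ 2 / (2 * c) * ‖(w : L2 ℓ d)‖ ^ 2) := by
  have hc := h.pos
  have e := h.inner_eq w w
  rw [inner_self_eq_norm_sq_to_K] at e
  have e1 : c * ‖domDeriv ℓ d w‖ ^ 2 ≤ ‖(inner ℂ (w : L2 ℓ d) (T w) : ℂ)‖ +
      ‖(inner ℂ (w : L2 ℓ d) (B (w, domDeriv ℓ d w)) : ℂ)‖ := by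
    have : (c : ℂ) * (‖domDeriv ℓ d w‖ : ℂ) ^ 2 = inner ℂ (w : L2 ℓ d) (T w) +
      inner ℂ (w : L2 ℓ d) (B (w, domDeriv ℓ d w)) := by rw [e]; simp
    have h2 := norm_add_le (inner ℂ (w : L2 ℓ d) (T w) : ℂ)
      (inner ℂ (w : L2 ℓ d) (B (w, domDeriv ℓ d w)))
    rw [← this] at h2
    rw [← Complex.ofReal_pow, ← Complex.ofReal_mul, Complex.norm_real, Real.norm_of_nonneg
      (by positivity)] at h2
    exact h2
  have e2 : ‖(inner ℂ (w : L2 ℓ d) (B (w, domDeriv ℓ d w)) : ℂ)‖ ≤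
      ‖(w : L2 ℓ d)‖ * (‖B‖ * (‖(w : L2 ℓ d)‖ + ‖domDeriv ℓ d w‖)) := by
    refine (norm_inner_le_norm _ _).trans (mul_le_mul_of_nonneg_left ?_ (norm_nonneg _))
    refine (B.le_opNorm _).trans (mul_le_mul_of_nonneg_left ?_ (norm_nonneg _))
    exact max_le (by simp) (by simp)
  set n := ‖(w : L2 ℓ d)‖
  set m := ‖domDeriv ℓ d w‖
  -- Young's inequality with weight `c / 2`, so that half of `c * m ^ 2` remains after absorbing the
  -- perturbation.
  have e3 : n * ‖B‖ * m ≤ c / 2 * m ^ 2 + ‖B‖ ^ 2 / (2 * c) * n ^ 2 := by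
    have : c / 2 * m ^ 2 + ‖B‖ ^ 2 / (2 * c) * n ^ 2 - n * ‖B‖ * m =
      (c * m - ‖B‖ * n) ^ 2 / (2 * c) := by
      field_simp
      ring
    have h3 : 0 ≤ (c * m - ‖B‖ * n) ^ 2 / (2 * c) := by positivity
    linarith
  rw [div_mul_eq_mul_div, le_div_iff₀ hc]
  nlinarith

theorem IsPerturbedLaplacian.norm_quadForm_le (h : IsPerturbedLaplacian c B T)
    (w : dirDomain ℓ d) :
    ‖(inner ℂ (w : L2 ℓ d) (T w) : ℂ)‖ ≤ c * ‖domDeriv ℓ d w‖ ^ 2 +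
      ‖(w : L2 ℓ d)‖ * (‖B‖ * (‖(w : L2 ℓ d)‖ + ‖domDeriv ℓ d w‖)) := by
  have hc := h.pos
  rw [h.inner_eq w w, inner_self_eq_norm_sq_to_K]
  refine (norm_sub_le _ _).trans (add_le_add ?_ ?_)
  · simp [abs_of_pos hc]
  · refine (norm_inner_le_norm _ _).trans (mul_le_mul_of_nonneg_left ?_ (norm_nonneg _))
    refine (B.le_opNorm _).trans (mul_le_mul_of_nonneg_left ?_ (norm_nonneg _))
    exact max_le (by simp) (by simp)

/-- Approximation in the form sense is approximation in `H¹`. -/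
theorem IsPerturbedLaplacian.formApprox_iff (h : IsPerturbedLaplacian c B T) {ψ : L2 ℓ d}
    {u : ℕ → dirDomain ℓ d} :
    FormApprox (⟨dirDomain ℓ d, T⟩ : L2 ℓ d →ₗ.[ℂ] L2 ℓ d) ψ u ↔
      Tendsto (fun n => (u n : L2 ℓ d)) atTop (𝓝 ψ) ∧
        ∃ g, Tendsto (fun n => domDeriv ℓ d (u n)) atTop (𝓝 g) := by
  unfold FormApprox
  refine and_congr_right fun hu => ?_
  have hn : Tendsto (fun p : ℕ × ℕ => ‖((u p.1 - u p.2 : dirDomain ℓ d) : L2 ℓ d)‖) atTop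
      (𝓝 0) := by
    have := cauchySeq_iff_tendsto_dist_atTop_0.1 hu.cauchySeq
    simpa only [dist_eq_norm, Submodule.coe_sub] using this
  change Tendsto (fun p : ℕ × ℕ => (inner ℂ ((u p.1 - u p.2 : dirDomain ℓ d) : L2 ℓ d)
    (T (u p.1 - u p.2)) : ℂ)) atTop (𝓝 0) ↔ _
  have hcau : (∃ g, Tendsto (fun n => domDeriv ℓ d (u n)) atTop (𝓝 g)) ↔
      Tendsto (fun p : ℕ × ℕ => ‖domDeriv ℓ d (u p.1 - u p.2)‖) atTop (𝓝 0) := by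
    simp only [map_sub, ← dist_eq_norm]
    rw [← cauchySeq_iff_tendsto_dist_atTop_0 (u := fun n => domDeriv ℓ d (u n))]
    exact ⟨fun ⟨_, hg⟩ => hg.cauchySeq, cauchySeq_tendsto_of_complete⟩
  rw [hcau, tendsto_zero_iff_norm_tendsto_zero]
  constructor
  · intro hq
    have h1 : Tendsto (fun p : ℕ × ℕ => ‖domDeriv ℓ d (u p.1 - u p.2)‖ ^ 2) atTop (𝓝 0) := by
      refine squeeze_zero (fun _ => by positivity)
        (fun p => h.norm_domDeriv_sq_le (u p.1 - u p.2)) ?_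
      have := ((hq.add ((hn.pow 2).const_mul ‖B‖)).add
        ((hn.pow 2).const_mul (‖B‖ ^ 2 / (2 * c)))).const_mul (2 / c)
      simpa using this
    have h2 := h1.sqrt
    simpa [Real.sqrt_sq (norm_nonneg _)] using h2
  · intro hm
    refine squeeze_zero (fun _ => norm_nonneg _) (fun p => h.norm_quadForm_le (u p.1 - u p.2)) ?_
    have := ((hm.pow 2).const_mul c).add (hn.mul ((hn.add hm).const_mul ‖B‖))
    simpa using this

/-- Approximation of a pair `(ψ, ψ')` by elements of `𝒟_Dir`. -/
def GraphApprox (u : ℕ → dirDomain ℓ d) (p : L2 ℓ d × L2 ℓ d) : Prop :=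
  Tendsto (fun n => ((u n : L2 ℓ d), domDeriv ℓ d (u n))) atTop (𝓝 p)

theorem GraphApprox.mem_closure {u : ℕ → dirDomain ℓ d} {p : L2 ℓ d × L2 ℓ d}
    (h : GraphApprox u p) : p ∈ (testGraph ℓ d).topologicalClosure :=
  (Submodule.isClosed_topologicalClosure _).mem_of_tendsto h
    (Eventually.of_forall fun n => domDeriv_mem_closure (u n))

theorem IsPerturbedLaplacian.formApprox_iff_graphApprox (h : IsPerturbedLaplacian c B T)
    {ψ : L2 ℓ d} {u : ℕ → dirDomain ℓ d} :
    FormApprox (⟨dirDomain ℓ d, T⟩ : L2 ℓ d →ₗ.[ℂ] L2 ℓ d) ψ u ↔ ∃ g, GraphApprox u (ψ, g) := by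
  rw [h.formApprox_iff]
  constructor
  · rintro ⟨h1, g, h2⟩
    exact ⟨g, h1.prodMk_nhds h2⟩
  · rintro ⟨g, hg⟩
    exact ⟨hg.fst_nhds, g, hg.snd_nhds⟩

theorem IsPerturbedLaplacian.tendsto_inner (h : IsPerturbedLaplacian c B T)
    {u v : ℕ → dirDomain ℓ d} {p q : L2 ℓ d × L2 ℓ d} (hu : GraphApprox u p)
    (hv : GraphApprox v q) :
    Tendsto (fun n => (inner ℂ (u n : L2 ℓ d) (T (v n)) : ℂ)) atTop
      (𝓝 (c * inner ℂ p.2 q.2 - inner ℂ p.1 (B q))) := by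
  simp_rw [h.inner_eq]
  exact ((hu.snd_nhds.inner hv.snd_nhds).const_mul _).sub
    (hu.fst_nhds.inner ((B.continuous.tendsto q).comp hv))

theorem IsPerturbedLaplacian.mem_formDomain_iff (h : IsPerturbedLaplacian c B T) {ψ : L2 ℓ d} :
    ψ ∈ formDomain (⟨dirDomain ℓ d, T⟩ : L2 ℓ d →ₗ.[ℂ] L2 ℓ d) ↔
      ∃ u g, GraphApprox u (ψ, g) :=
  exists_congr fun _ => h.formApprox_iff_graphApprox

/-- The closed form `c ⟨φ', ψ'⟩ - ⟨φ, B (ψ, ψ')⟩`. -/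
theorem IsPerturbedLaplacian.isFormValue_iff (h : IsPerturbedLaplacian c B T)
    {u v : ℕ → dirDomain ℓ d} {p q : L2 ℓ d × L2 ℓ d} (hu : GraphApprox u p)
    (hv : GraphApprox v q) {z : ℂ} :
    IsFormValue (⟨dirDomain ℓ d, T⟩ : L2 ℓ d →ₗ.[ℂ] L2 ℓ d) p.1 q.1 z ↔
      z = c * inner ℂ p.2 q.2 - inner ℂ p.1 (B q) := by
  constructor
  · rintro ⟨u', v', hu', hv', hz⟩
    obtain ⟨g, hg⟩ := h.formApprox_iff_graphApprox.1 hu'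
    obtain ⟨k, hk⟩ := h.formApprox_iff_graphApprox.1 hv'
    -- Weak derivatives are unique, so any approximating sequence has the same derivative limit and
    -- the form value does not depend on it.
    have e1 : g = p.2 := (hasWeakDeriv_of_mem_closure hg.mem_closure).unique
      (hasWeakDeriv_of_mem_closure hu.mem_closure)
    have e2 : k = q.2 := (hasWeakDeriv_of_mem_closure hk.mem_closure).unique
      (hasWeakDeriv_of_mem_closure hv.mem_closure)
    subst e1 e2
    exact tendsto_nhds_unique hz (h.tendsto_inner hg hk)
  · rintro rfl
    exact ⟨u, v, h.formApprox_iff_graphApprox.2 ⟨p.2, hu⟩,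
      h.formApprox_iff_graphApprox.2 ⟨q.2, hv⟩, h.tendsto_inner hu hv⟩

theorem isPerturbedLaplacian_dirLaplacian (ℓ d : ℝ) :
    IsPerturbedLaplacian 1 0 (dirLaplacian ℓ d) :=
  ⟨one_pos, fun u v => by simp [inner_dirLaplacian_dom]⟩

end FormGraph

/-! ### The first-order part of the auxiliary Hamiltonian -/

section MulX

variable {ℓ d : ℝ}

theorem mulX_coeFn (f : L2 ℓ d) : mulX ℓ d f =ᵐ[boxMeasure ℓ d] fun x => (x : ℂ) * f x :=
  (memLp_mulX f).coeFn_toLp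

theorem norm_mulX_le (f : L2 1 0) : ‖mulX 1 0 f‖ ≤ ‖f‖ := by
  refine Lp.norm_le_norm_of_ae_le ?_
  filter_upwards [mulX_coeFn f, ae_restrict_mem (measurableSet_box 1 0)] with x hx hb
  rw [hx, norm_mul, Complex.norm_real]
  refine mul_le_of_le_one_left (norm_nonneg _) ?_
  rw [Real.norm_eq_abs, abs_le]
  constructor <;> linarith [hb.1, hb.2]

/-- The position operator on the unit box, as a bounded operator. -/
noncomputable def mulXL : L2 1 0 →L[ℂ] L2 1 0 :=
  (mulX 1 0).mkContinuous 1 fun f => by rw [one_mul]; exact norm_mulX_le f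

theorem inner_mulX_left (f g : L2 ℓ d) :
    (inner ℂ (mulX ℓ d f) g : ℂ) = inner ℂ f (mulX ℓ d g) := by
  rw [L2.inner_def, L2.inner_def]
  refine integral_congr_ae ?_
  filter_upwards [mulX_coeFn f, mulX_coeFn g] with x h1 h2
  rw [h1, h2, RCLike.inner_apply, RCLike.inner_apply, map_mul, Complex.conj_ofReal]
  ring

/-- The action of `i ((ℓ'/ℓ) x ∘ p + (d'/ℓ) p)` on a pair `(ψ, ψ')`. -/
noncomputable def dilationGen (ℓ ℓ' d' : ℝ) : L2 1 0 × L2 1 0 →L[ℂ] L2 1 0 :=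
  ((ℓ' / ℓ : ℝ) : ℂ) • ((1 / 2 : ℂ) • ContinuousLinearMap.fst ℂ _ _
    + mulXL ∘L ContinuousLinearMap.snd ℂ _ _)
  + ((d' / ℓ : ℝ) : ℂ) • ContinuousLinearMap.snd ℂ _ _

theorem dilationGen_apply (ℓ ℓ' d' : ℝ) (p : L2 1 0 × L2 1 0) :
    dilationGen ℓ ℓ' d' p = ((ℓ' / ℓ : ℝ) : ℂ) • ((1 / 2 : ℂ) • p.1 + mulX 1 0 p.2)
      + ((d' / ℓ : ℝ) : ℂ) • p.2 := rfl

/-- `i ((ℓ'/ℓ) x ∘ p + (d'/ℓ) p)` is antisymmetric. -/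
theorem inner_dilationGen (ℓ ℓ' d' : ℝ) {p q : L2 1 0 × L2 1 0}
    (hp : p ∈ (testGraph 1 0).topologicalClosure) (hq : HasWeakDeriv q.1 q.2) :
    (inner ℂ (dilationGen ℓ ℓ' d' p) q.1 : ℂ) = -inner ℂ p.1 (dilationGen ℓ ℓ' d' q) := by
  -- Integrate by parts against both `q` and `x q`; the Leibniz term from `(x q)' = q + x q'` is
  -- balanced by the two halves `1/2`.
  have h1 := hq.inner_eq hp
  have h2 := hq.mulX.inner_eq hp
  rw [inner_add_right] at h2
  simp only [dilationGen_apply, inner_add_left, inner_add_right, inner_smul_left, inner_smul_right,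
    inner_mulX_left, Complex.conj_ofReal, map_div₀, map_one, map_ofNat]
  rw [h1, h2]
  ring

/-- The action of the auxiliary Hamiltonian. -/
noncomputable def auxAction (ℓ ℓ' d' : ℝ) : dirDomain 1 0 →ₗ[ℂ] L2 1 0 :=
  (auxHamiltonian ℓ ℓ' d').toFun

/-- By the Leibniz rule, `x p + p x = -i (2 x ∂ + 1)`, so the subtracted first-order part is exactly
`-i` times `dilationGen`. -/
theorem isPerturbedLaplacian_auxAction {ℓ : ℝ} (hℓ : 0 < ℓ) (ℓ' d' : ℝ) :
    IsPerturbedLaplacian (1 / ℓ ^ 2) ((-Complex.I) • dilationGen ℓ ℓ' d')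
      (auxAction ℓ ℓ' d') := by
  refine ⟨by positivity, fun u v => ?_⟩
  have e : auxAction ℓ ℓ' d' v = ((1 / ℓ ^ 2 : ℝ) : ℂ) • dirLaplacian 1 0 v -
      ((-Complex.I) • dilationGen ℓ ℓ' d') (v, domDeriv 1 0 v) := by
    have hx : weakDeriv 1 0 (mulX1 1 0 (Submodule.inclusion (dirDomain_le_H1 1 0) v)) =
        v + mulX 1 0 (domDeriv 1 0 v) :=
      weakDeriv_eq (f := mulX1 1 0 (Submodule.inclusion (dirDomain_le_H1 1 0) v))
        (hasWeakDeriv_domDeriv v).mulX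
    change ((1 / ℓ ^ 2 : ℝ) : ℂ) • dirLaplacian 1 0 v - (((ℓ' / ℓ : ℝ) : ℂ) • ((1 / 2 : ℂ) •
      (mulX 1 0 ((-Complex.I) • domDeriv 1 0 v) + (-Complex.I) •
        weakDeriv 1 0 (mulX1 1 0 (Submodule.inclusion (dirDomain_le_H1 1 0) v)))) +
      ((d' / ℓ : ℝ) : ℂ) • ((-Complex.I) • domDeriv 1 0 v)) = _
    rw [hx, smul_apply, dilationGen_apply, map_smul]
    congr 1
    module
  rw [e, inner_sub_right, inner_smul_right, inner_dirLaplacian_dom]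

end MulX

/-! ### Operators that intertwine weak derivatives up to a factor -/

section Scaling

variable {ℓ d ℓ' d' : ℝ}

/-- A bounded operator between the `L²` spaces of two boxes that acts like a dilation: with a
scaling factor `c` for the derivative, it preserves test functions and weak derivatives. -/
structure IsScaling (S : L2 ℓ d →L[ℂ] L2 ℓ' d') (c : ℂ) : Prop where
  testGraph : ∀ p ∈ testGraph ℓ d, (S p.1, c • S p.2) ∈ testGraph ℓ' d'
  weakDeriv : ∀ f g, HasWeakDeriv f g → HasWeakDeriv (S f) (c • S g)

theorem IsScaling.mem_closure {S : L2 ℓ d →L[ℂ] L2 ℓ' d'} {c : ℂ} (h : IsScaling S c)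
    {p : L2 ℓ d × L2 ℓ d} (hp : p ∈ (MovingBox.testGraph ℓ d).topologicalClosure) :
    (S p.1, c • S p.2) ∈ (MovingBox.testGraph ℓ' d').topologicalClosure := by
  have hc : Continuous fun p : L2 ℓ d × L2 ℓ d => (S p.1, c • S p.2) := by fun_prop
  exact map_mem_closure (f := fun p : L2 ℓ d × L2 ℓ d => (S p.1, c • S p.2)) hc hp h.testGraph

theorem IsScaling.mem_dirDomain {S : L2 ℓ d →L[ℂ] L2 ℓ' d'} {c : ℂ} (h : IsScaling S c)
    (u : dirDomain ℓ d) : S u ∈ dirDomain ℓ' d' :=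
  mem_dirDomain_of_closure (h.mem_closure (domDeriv_mem_closure u))
    ((h.weakDeriv _ _ (hasWeakDeriv_dirLaplacian u)).smul c)

theorem IsScaling.graphApprox {S : L2 ℓ d →L[ℂ] L2 ℓ' d'} {c : ℂ} (h : IsScaling S c)
    {u : ℕ → dirDomain ℓ d} {p : L2 ℓ d × L2 ℓ d} (hu : GraphApprox u p) :
    GraphApprox (fun n => (⟨S (u n), h.mem_dirDomain (u n)⟩ : dirDomain ℓ' d'))
      (S p.1, c • S p.2) := by
  have hc : Continuous fun p : L2 ℓ d × L2 ℓ d => (S p.1, c • S p.2) := by fun_prop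
  have := (hc.tendsto p).comp hu
  refine this.congr fun n => ?_
  rw [domDeriv_eq (u := ⟨S (u n), h.mem_dirDomain (u n)⟩)
    (h.weakDeriv _ _ (hasWeakDeriv_domDeriv (u n)))]
  rfl

theorem IsTestFunction.comp_affine {η : ℝ → ℂ} (h : IsTestFunction ℓ d η) {k e : ℝ} (hk : k ≠ 0)
    (hbox : ∀ x, k * x + e ∈ interior (box ℓ d) → x ∈ interior (box ℓ' d')) (c : ℂ) :
    IsTestFunction ℓ' d' fun x => c * η (k * x + e) := by
  let φ : ℝ ≃ₜ ℝ := (Homeomorph.mulLeft₀ k hk).trans (Homeomorph.addRight e)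
  have hs : Function.support (fun x => c * η (k * x + e)) ⊆ Function.support (η ∘ φ) :=
    Function.support_mul_subset_right _ _
  refine ⟨?_, ?_, ?_⟩
  · exact contDiff_const.mul (h.smooth.comp ((contDiff_const.mul contDiff_id).add contDiff_const))
  · exact (h.compact.comp_homeomorph φ).mono hs
  · refine (closure_mono hs).trans ?_
    change tsupport (η ∘ φ) ⊆ _
    rw [tsupport_comp_eq_preimage]
    intro x hx
    exact hbox x (h.supp hx)

theorem IsTestFunction.deriv_comp_affine {η : ℝ → ℂ} (h : IsTestFunction ℓ d η) (k e : ℝ) (c : ℂ)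
    (x : ℝ) : deriv (fun x => c * η (k * x + e)) x = c * (k * deriv η (k * x + e)) := by
  have h1 : HasDerivAt (fun x : ℝ => k * x + e) k x := by
    simpa using ((hasDerivAt_id x).const_mul k).add_const e
  have h2 := (h.smooth.differentiable (by simp) (k * x + e)).hasDerivAt.scomp x h1
  have h3 := (h2.const_mul c).deriv
  rw [Complex.real_smul] at h3
  exact h3

end Scaling

/-! ### Unitarity of `W` and its action on derivatives -/

section Dilation

variable {ℓ d : ℝ}

theorem W_coeFn (f : L2 ℓ d) :
    W ℓ d f =ᵐ[boxMeasure 1 0] fun x => ((√ℓ : ℝ) : ℂ) * f (ℓ * x + d) :=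
  (memLp_dilation f).coeFn_toLp

theorem W_ae_eq {f : L2 ℓ d} {u : ℝ → ℂ} (h : f =ᵐ[boxMeasure ℓ d] u) :
    W ℓ d f =ᵐ[boxMeasure 1 0] fun x => ((√ℓ : ℝ) : ℂ) * u (ℓ * x + d) :=
  (W_coeFn f).trans (dilation_congr h)

theorem norm_W (hℓ : 0 < ℓ) (f : L2 ℓ d) : ‖W ℓ d f‖ = ‖f‖ := by
  change ‖(memLp_dilation f).toLp _‖ = _
  rw [Lp.norm_toLp, eLpNorm_dilation hℓ, Lp.norm_def]

theorem boxMeasure_eq_smul_map (d : ℝ) (hℓ : 0 < ℓ) :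
    boxMeasure ℓ d = ENNReal.ofReal ℓ • (boxMeasure 1 0).map (fun x => ℓ * x + d) := by
  rw [map_affine_boxMeasure d hℓ, smul_smul, ← ENNReal.ofReal_mul hℓ.le, mul_inv_cancel₀ hℓ.ne',
    ENNReal.ofReal_one, one_smul]

theorem W_surjective (hℓ : 0 < ℓ) : Function.Surjective (W ℓ d) := by
  intro f
  have hm : Measurable fun x : ℝ => ℓ * x + d := by fun_prop
  -- The representative is strongly measurable everywhere, so composing it with an affine map raises
  -- no null-set question.
  have hs := Lp.stronglyMeasurable f
  let g : ℝ → ℂ := fun y => (((√ℓ)⁻¹ : ℝ) : ℂ) * f ((y - d) / ℓ)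
  have hg : StronglyMeasurable g := by
    refine stronglyMeasurable_const.mul (hs.comp_measurable ?_)
    fun_prop
  have e (x : ℝ) : g (ℓ * x + d) = (((√ℓ)⁻¹ : ℝ) : ℂ) * f x := by
    simp only [g]
    congr 2
    field_simp
    ring
  have hL : MemLp g 2 (boxMeasure ℓ d) := by
    refine ⟨hg.aestronglyMeasurable, ?_⟩
    rw [boxMeasure_eq_smul_map d hℓ,
      eLpNorm_smul_measure_of_ne_zero (by simpa using hℓ), smul_eq_mul,
      eLpNorm_map_measure hg.aestronglyMeasurable hm.aemeasurable]
    refine ENNReal.mul_lt_top (ENNReal.rpow_lt_top_of_nonneg (by simp) (by simp)) ?_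
    have : g ∘ (fun x => ℓ * x + d) = (((√ℓ)⁻¹ : ℝ) : ℂ) • f := funext e
    rw [this]
    exact ((Lp.memLp f).const_smul _).2
  refine ⟨hL.toLp g, Lp.ext ((W_ae_eq hL.coeFn_toLp).trans (Eventually.of_forall fun x => ?_))⟩
  simp only [e]
  rw [← mul_assoc, ← Complex.ofReal_mul, mul_inv_cancel₀ (Real.sqrt_pos.2 hℓ).ne']
  simp

/-- The unitary operator `W_{ℓ,d}`. -/
noncomputable def unitaryW (d : ℝ) (hℓ : 0 < ℓ) : L2 ℓ d ≃ₗᵢ[ℂ] L2 1 0 :=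
  LinearIsometryEquiv.ofSurjective ⟨(W ℓ d).toLinearMap, norm_W hℓ⟩ (W_surjective hℓ)

theorem unitaryW_apply (hℓ : 0 < ℓ) (f : L2 ℓ d) : unitaryW d hℓ f = W ℓ d f := rfl

theorem adjoint_W (hℓ : 0 < ℓ) (f : L2 1 0) : (W ℓ d).adjoint f = (unitaryW d hℓ).symm f := by
  refine ext_inner_right ℂ fun g => ?_
  rw [ContinuousLinearMap.adjoint_inner_left, ← unitaryW_apply hℓ,
    ← LinearIsometryEquiv.inner_map_map (unitaryW d hℓ) ((unitaryW d hℓ).symm f),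
    LinearIsometryEquiv.apply_symm_apply]

theorem W_adjoint_apply (hℓ : 0 < ℓ) (f : L2 1 0) : W ℓ d ((W ℓ d).adjoint f) = f := by
  rw [adjoint_W hℓ, ← unitaryW_apply hℓ, LinearIsometryEquiv.apply_symm_apply]

theorem adjoint_W_apply (hℓ : 0 < ℓ) (f : L2 ℓ d) : (W ℓ d).adjoint (W ℓ d f) = f := by
  rw [adjoint_W hℓ, ← unitaryW_apply hℓ, LinearIsometryEquiv.symm_apply_apply]

theorem norm_adjoint_W (hℓ : 0 < ℓ) (f : L2 1 0) : ‖(W ℓ d).adjoint f‖ = ‖f‖ := by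
  rw [adjoint_W hℓ, LinearIsometryEquiv.norm_map]

theorem mem_interior_box {x : ℝ} : x ∈ interior (box ℓ d) ↔ d - ℓ / 2 < x ∧ x < d + ℓ / 2 := by
  rw [box, interior_Icc, mem_Ioo]

theorem W_mem_testGraph (hℓ : 0 < ℓ) {p : L2 ℓ d × L2 ℓ d} (hp : p ∈ testGraph ℓ d) :
    (W ℓ d p.1, (ℓ : ℂ) • W ℓ d p.2) ∈ testGraph 1 0 := by
  obtain ⟨η, hη, h1, h2⟩ := hp
  refine ⟨fun x => ((√ℓ : ℝ) : ℂ) * η (ℓ * x + d), hη.comp_affine hℓ.ne' (fun x hx => ?_) _,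
    W_ae_eq h1, ?_⟩
  · rw [mem_interior_box] at hx ⊢
    constructor <;> nlinarith [hx.1, hx.2]
  · filter_upwards [Lp.coeFn_smul (ℓ : ℂ) (W ℓ d p.2), W_ae_eq h2] with x h3 h4
    rw [h3, Pi.smul_apply, h4, hη.deriv_comp_affine, smul_eq_mul]
    ring

/-- The pair `q` is `W` of an explicit rescaled test pair, up to the factor `ℓ` on the derivative,
and `W† W = 1` recovers that pair. -/
theorem adjoint_W_mem_testGraph (hℓ : 0 < ℓ) {q : L2 1 0 × L2 1 0} (hq : q ∈ testGraph 1 0) :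
    ((W ℓ d).adjoint q.1, (ℓ : ℂ)⁻¹ • (W ℓ d).adjoint q.2) ∈ testGraph ℓ d := by
  obtain ⟨θ, hθ, h1, h2⟩ := hq
  have hsq : ((√ℓ : ℝ) : ℂ) ≠ 0 := by exact_mod_cast (Real.sqrt_pos.2 hℓ).ne'
  have hc : (ℓ : ℂ) ≠ 0 := by exact_mod_cast hℓ.ne'
  have hη : IsTestFunction ℓ d fun y => ((√ℓ : ℝ) : ℂ)⁻¹ * θ (ℓ⁻¹ * y + -(ℓ⁻¹ * d)) := by
    refine hθ.comp_affine (inv_ne_zero hℓ.ne') (fun y hy => ?_) _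
    rw [mem_interior_box] at hy ⊢
    have e : y = ℓ * (ℓ⁻¹ * y + -(ℓ⁻¹ * d)) + d := by field_simp; ring
    rw [e]
    constructor <;> nlinarith [hy.1, hy.2]
  have e (x : ℝ) : ℓ⁻¹ * (ℓ * x + d) + -(ℓ⁻¹ * d) = x := by field_simp; ring
  have h3 := W_ae_eq (MemLp.coeFn_toLp (hη.memLp (boxMeasure ℓ d)))
  have h4 := W_ae_eq (MemLp.coeFn_toLp (hη.memLp_deriv (boxMeasure ℓ d)))
  have e1 : q.1 = W ℓ d (MemLp.toLp _ (hη.memLp (boxMeasure ℓ d))) := by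
    refine Lp.ext ?_
    filter_upwards [h1, h3] with x h5 h6
    rw [h5, h6, e, mul_inv_cancel_left₀ hsq]
  have e2 : q.2 = (ℓ : ℂ) • W ℓ d (MemLp.toLp _ (hη.memLp_deriv (boxMeasure ℓ d))) := by
    refine Lp.ext ?_
    filter_upwards [h2, h4, Lp.coeFn_smul (ℓ : ℂ)
      (W ℓ d (MemLp.toLp _ (hη.memLp_deriv (boxMeasure ℓ d))))] with x h5 h6 h7
    rw [h5, h7, Pi.smul_apply, h6, hθ.deriv_comp_affine, e, mul_inv_cancel_left₀ hsq, smul_eq_mul,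
      Complex.ofReal_inv, mul_inv_cancel_left₀ hc]
  rw [e1, e2, map_smul, adjoint_W_apply hℓ, adjoint_W_apply hℓ, inv_smul_smul₀ hc]
  exact hη.toLp_mem_testGraph

/-- Weak derivatives are handled by duality: tested against `q`, the operator `W` passes to the test
pair as `W†`, which maps test pairs to test pairs. -/
theorem isScaling_W (d : ℝ) (hℓ : 0 < ℓ) : IsScaling (W ℓ d) ℓ := by
  refine ⟨fun p hp => W_mem_testGraph hℓ hp, fun f g h => ?_⟩
  rw [hasWeakDeriv_iff] at h ⊢
  intro q hq
  have hc : (ℓ : ℂ) ≠ 0 := by exact_mod_cast hℓ.ne'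
  have := h _ (adjoint_W_mem_testGraph hℓ hq)
  simp only [inner_smul_left, ContinuousLinearMap.adjoint_inner_left, map_inv₀,
    Complex.conj_ofReal] at this
  rw [inner_smul_right, ← mul_neg, ← this, mul_inv_cancel_left₀ hc]

theorem isScaling_adjoint_W (d : ℝ) (hℓ : 0 < ℓ) : IsScaling (W ℓ d).adjoint (ℓ : ℂ)⁻¹ := by
  refine ⟨fun p hp => adjoint_W_mem_testGraph hℓ hp, fun f g h => ?_⟩
  rw [hasWeakDeriv_iff] at h ⊢
  intro q hq
  have hc : (ℓ : ℂ) ≠ 0 := by exact_mod_cast hℓ.ne'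
  have := h _ (W_mem_testGraph hℓ hq)
  simp only [inner_smul_left, Complex.conj_ofReal] at this
  rw [inner_smul_right, ContinuousLinearMap.adjoint_inner_right,
    ContinuousLinearMap.adjoint_inner_right, ← mul_right_inj' hc, this]
  field_simp

end Dilation

/-! ### Restriction to a moving box followed by `W` -/

section Pullback

variable {ℓ d : ℝ}

/-- `W_{ℓ,d}` after restriction to `Ω_{ℓ,d}`, from `L²(ℝ)` to `L²(Ω)`. -/
noncomputable def pullback (ℓ d : ℝ) : L2R →L[ℂ] L2 1 0 :=
  W ℓ d ∘L (extend ℓ d).toContinuousLinearMap.adjoint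

theorem extend_coeFn (f : L2 ℓ d) : extend ℓ d f =ᵐ[volume] (box ℓ d).indicator f :=
  (memLp_extend f).coeFn_toLp

theorem adjoint_extend_coeFn (f : L2R) :
    (extend ℓ d).toContinuousLinearMap.adjoint f =ᵐ[boxMeasure ℓ d] f := by
  have hL : MemLp f 2 (boxMeasure ℓ d) := (Lp.memLp f).restrict _
  suffices (extend ℓ d).toContinuousLinearMap.adjoint f = hL.toLp f by
    rw [this]
    exact hL.coeFn_toLp
  refine ext_inner_left ℂ fun g => ?_
  rw [ContinuousLinearMap.adjoint_inner_right]
  change inner ℂ (extend ℓ d g) f = _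
  rw [L2.inner_def, L2.inner_def, ← integral_indicator (measurableSet_box ℓ d)]
  have h2 := (ae_restrict_iff' (measurableSet_box ℓ d)).1 hL.coeFn_toLp
  refine integral_congr_ae ?_
  filter_upwards [extend_coeFn g, h2] with x h1 h2
  rw [h1]
  by_cases hx : x ∈ box ℓ d
  · rw [indicator_of_mem hx, indicator_of_mem hx, h2 hx]
  · rw [indicator_of_notMem hx, indicator_of_notMem hx, inner_zero_left]

theorem pullback_ae_eq {f : L2R} {u : ℝ → ℂ} (h : f =ᵐ[volume] u) :
    pullback ℓ d f =ᵐ[boxMeasure 1 0] fun x => ((√ℓ : ℝ) : ℂ) * u (ℓ * x + d) :=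
  W_ae_eq ((adjoint_extend_coeFn f).trans (ae_restrict_of_ae h))

theorem adjoint_extend_apply (f : L2 ℓ d) :
    (extend ℓ d).toContinuousLinearMap.adjoint (extend ℓ d f) = f := by
  refine ext_inner_right ℂ fun g => ?_
  rw [ContinuousLinearMap.adjoint_inner_left]
  exact (extend ℓ d).inner_map_map f g

theorem pullback_extend (f : L2 ℓ d) : pullback ℓ d (extend ℓ d f) = W ℓ d f := by
  change W ℓ d ((extend ℓ d).toContinuousLinearMap.adjoint (extend ℓ d f)) = _
  rw [adjoint_extend_apply]

theorem norm_pullback_le (hℓ : 0 < ℓ) (f : L2R) : ‖pullback ℓ d f‖ ≤ ‖f‖ := by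
  change ‖W ℓ d ((extend ℓ d).toContinuousLinearMap.adjoint f)‖ ≤ _
  rw [norm_W hℓ]
  refine (ContinuousLinearMap.le_opNorm _ _).trans (mul_le_of_le_one_left (norm_nonneg _) ?_)
  rw [LinearIsometryEquiv.norm_map]
  exact LinearIsometry.norm_toContinuousLinearMap_le _

/-- Moves the time dependence of the space onto the test vector, so that trajectories are compared
on the unit box. -/
theorem inner_extend_adjoint_W (f : L2R) (g : L2 1 0) :
    (inner ℂ f (extend ℓ d ((W ℓ d).adjoint g)) : ℂ) = inner ℂ (pullback ℓ d f) g := by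
  change (inner ℂ f ((extend ℓ d).toContinuousLinearMap ((W ℓ d).adjoint g)) : ℂ) =
    inner ℂ (W ℓ d ((extend ℓ d).toContinuousLinearMap.adjoint f)) g
  rw [← ContinuousLinearMap.adjoint_inner_left, ContinuousLinearMap.adjoint_inner_right]

end Pullback

/-! ### Smooth dependence of `η (ℓ x + d)` on `(ℓ, d)` -/

section Sample

theorem L2_norm_le_of_ae_bound {f : L2 1 0} {C : ℝ} (hC : 0 ≤ C)
    (h : ∀ᵐ x ∂boxMeasure 1 0, ‖f x‖ ≤ C) : ‖f‖ ≤ C := by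
  have h1 := Lp.norm_le_of_ae_bound hC h
  have h2 : measureUnivNNReal (boxMeasure 1 0) = 1 := by
    rw [← ENNReal.coe_inj, coe_measureUnivNNReal, Measure.restrict_apply_univ, box, Real.volume_Icc]
    norm_num
  rw [h2] at h1
  simpa using h1

variable {η : ℝ → ℂ}

theorem memLp_sample (hc : Continuous η) (hs : HasCompactSupport η) (q : ℝ × ℝ) :
    MemLp (fun x => η (q.1 * x + q.2)) 2 (boxMeasure 1 0) := by
  obtain ⟨C, hC⟩ := hs.exists_bound_of_continuous hc
  exact MemLp.of_bound (by fun_prop) C (Eventually.of_forall fun x => hC _)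

/-- The function `x ↦ η (ℓ x + d)` on the unit box, with `q = (ℓ, d)`. -/
noncomputable def sample (hc : Continuous η) (hs : HasCompactSupport η) (q : ℝ × ℝ) : L2 1 0 :=
  (memLp_sample hc hs q).toLp _

theorem sample_coeFn (hc : Continuous η) (hs : HasCompactSupport η) (q : ℝ × ℝ) :
    sample hc hs q =ᵐ[boxMeasure 1 0] fun x => η (q.1 * x + q.2) :=
  (memLp_sample hc hs q).coeFn_toLp

theorem pullback_eq_sample (hc : Continuous η) (hs : HasCompactSupport η) {f : L2R}
    (hf : f =ᵐ[volume] η) (ℓ d : ℝ) :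
    pullback ℓ d f = ((√ℓ : ℝ) : ℂ) • sample hc hs (ℓ, d) := by
  refine Lp.ext ?_
  filter_upwards [pullback_ae_eq (ℓ := ℓ) (d := d) hf, sample_coeFn hc hs (ℓ, d),
    Lp.coeFn_smul ((√ℓ : ℝ) : ℂ) (sample hc hs (ℓ, d))] with x h1 h2 h3
  rw [h1, h3, Pi.smul_apply, h2, smul_eq_mul]

theorem abs_affine_sub_le {x : ℝ} (hx : x ∈ box 1 0) (p q : ℝ × ℝ) :
    |q.1 * x + q.2 - (p.1 * x + p.2)| ≤ 2 * ‖q - p‖ := by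
  have h1 : |q.1 - p.1| ≤ ‖q - p‖ := norm_fst_le (q - p)
  have h2 : |q.2 - p.2| ≤ ‖q - p‖ := norm_snd_le (q - p)
  have h3 : |x| ≤ 1 := abs_le.2 ⟨by linarith [hx.1], by linarith [hx.2]⟩
  have e : q.1 * x + q.2 - (p.1 * x + p.2) = (q.1 - p.1) * x + (q.2 - p.2) := by ring
  rw [e]
  have h4 : |(q.1 - p.1) * x| ≤ |q.1 - p.1| := by
    rw [abs_mul]
    exact mul_le_of_le_one_right (abs_nonneg _) h3
  linarith [abs_add_le ((q.1 - p.1) * x) (q.2 - p.2)]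

theorem continuous_sample (hc : Continuous η) (hs : HasCompactSupport η) :
    Continuous (sample hc hs) := by
  rw [Metric.continuous_iff]
  intro p ε hε
  obtain ⟨δ, hδ, h⟩ := Metric.uniformContinuous_iff.1 (hs.uniformContinuous_of_continuous hc)
    (ε / 2) (by positivity)
  refine ⟨δ / 2, by positivity, fun q hq => ?_⟩
  rw [dist_eq_norm] at hq ⊢
  refine lt_of_le_of_lt (L2_norm_le_of_ae_bound (C := ε / 2) (by positivity) ?_) (by linarith)
  filter_upwards [Lp.coeFn_sub (sample hc hs q) (sample hc hs p), sample_coeFn hc hs q,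
    sample_coeFn hc hs p, ae_restrict_mem (measurableSet_box 1 0)] with x h1 h2 h3 hx
  rw [h1, Pi.sub_apply, h2, h3, ← dist_eq_norm]
  refine (h ?_).le
  rw [Real.dist_eq]
  linarith [abs_affine_sub_le hx p q]

theorem exists_taylor_bound (h : ContDiff ℝ ∞ η) (hs : HasCompactSupport η) :
    ∃ C, 0 ≤ C ∧ ∀ y z : ℝ, ‖η z - η y - ((z - y : ℝ) : ℂ) * deriv η y‖ ≤ C * |z - y| ^ 2 := by
  have h1 : ContDiff ℝ ∞ (deriv η) := by
    rw [show (∞ : WithTop ℕ∞) = ∞ + 1 from rfl, contDiff_succ_iff_deriv] at h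
    exact h.2.2
  obtain ⟨C, hC⟩ := hs.deriv.deriv.exists_bound_of_continuous (h1.continuous_deriv (by simp))
  refine ⟨C, (norm_nonneg _).trans (hC 0), fun y z => ?_⟩
  have hlip (w : ℝ) : ‖deriv η w - deriv η y‖ ≤ C * ‖w - y‖ :=
    convex_univ.norm_image_sub_le_of_norm_hasDerivWithin_le
      (fun x _ => (h1.differentiable (by simp) x).hasDerivAt.hasDerivWithinAt)
      (fun x _ => hC x) (mem_univ y) (mem_univ w)
  have hd (x : ℝ) : HasDerivAt (fun w : ℝ => η w - (w : ℂ) * deriv η y) (deriv η x - deriv η y) x := by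
    have := (h.differentiable (by simp) x).hasDerivAt.fun_sub
      ((Complex.ofRealCLM.hasDerivAt (x := x)).mul_const (deriv η y))
    simpa using this
  -- Second use of the mean value inequality: `w ↦ η w - w η'(y)` has derivative `η' - η'(y)`, which
  -- `hlip` bounds by `C |z - y|` between `y` and `z`.
  have key := (convex_uIcc y z).norm_image_sub_le_of_norm_hasDerivWithin_le (C := C * |z - y|)
    (fun x _ => (hd x).hasDerivWithinAt) (fun x hx => (hlip x).trans ?_) left_mem_uIcc
    right_mem_uIcc
  · have e : η z - η y - ((z - y : ℝ) : ℂ) * deriv η y =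
        η z - (z : ℂ) * deriv η y - (η y - (y : ℂ) * deriv η y) := by
      push_cast; ring
    rw [e]
    refine key.trans (le_of_eq ?_)
    rw [Real.norm_eq_abs]
    ring
  · refine mul_le_mul_of_nonneg_left ?_ ((norm_nonneg _).trans (hC 0))
    rw [Real.norm_eq_abs]
    exact abs_sub_left_of_mem_uIcc hx

/-- The pointwise Taylor remainder is quadratic, uniformly on the unit box, and the box has measure
one, so the `L²` remainder is quadratic too. -/
theorem hasFDerivAt_sample (h : ContDiff ℝ ∞ η) (hs : HasCompactSupport η) (p : ℝ × ℝ) :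
    HasFDerivAt (sample h.continuous hs)
      ((ContinuousLinearMap.fst ℝ ℝ ℝ).smulRight
          (mulX 1 0 (sample (h.continuous_deriv (by simp)) hs.deriv p)) +
        (ContinuousLinearMap.snd ℝ ℝ ℝ).smulRight
          (sample (h.continuous_deriv (by simp)) hs.deriv p)) p := by
  obtain ⟨C, hC0, hC⟩ := exists_taylor_bound h hs
  set s' := sample (h.continuous_deriv (by simp)) hs.deriv p with hs'
  refine HasFDerivAt.of_isLittleO ?_
  have hO : (fun q : ℝ × ℝ => sample h.continuous hs q - sample h.continuous hs p -
      ((ContinuousLinearMap.fst ℝ ℝ ℝ).smulRight (mulX 1 0 s') +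
        (ContinuousLinearMap.snd ℝ ℝ ℝ).smulRight s') (q - p)) =O[𝓝 p]
      fun q => ‖q - p‖ ^ 2 := by
    -- The `4` is the square of the factor `2` in `abs_affine_sub_le`.
    refine Asymptotics.IsBigO.of_bound (C * 4) (Eventually.of_forall fun q => ?_)
    rw [Real.norm_of_nonneg (by positivity)]
    refine L2_norm_le_of_ae_bound (by positivity) ?_
    have e : ((ContinuousLinearMap.fst ℝ ℝ ℝ).smulRight (mulX 1 0 s') +
        (ContinuousLinearMap.snd ℝ ℝ ℝ).smulRight s') (q - p) =
        (q.1 - p.1) • mulX 1 0 s' + (q.2 - p.2) • s' := rfl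
    rw [e]
    filter_upwards [Lp.coeFn_sub (sample h.continuous hs q - sample h.continuous hs p)
        ((q.1 - p.1) • mulX 1 0 s' + (q.2 - p.2) • s'),
      Lp.coeFn_sub (sample h.continuous hs q) (sample h.continuous hs p),
      Lp.coeFn_add ((q.1 - p.1) • mulX 1 0 s') ((q.2 - p.2) • s'),
      Lp.coeFn_smul (q.1 - p.1) (mulX 1 0 s'), Lp.coeFn_smul (q.2 - p.2) s',
      mulX_coeFn s', sample_coeFn (h.continuous_deriv (by simp)) hs.deriv p,
      sample_coeFn h.continuous hs q, sample_coeFn h.continuous hs p,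
      ae_restrict_mem (measurableSet_box 1 0)] with x h1 h2 h3 h4 h5 h6 h7 h8 h9 hx
    rw [h1, Pi.sub_apply, h2, Pi.sub_apply, h3, Pi.add_apply, h4, h5, Pi.smul_apply, Pi.smul_apply,
      h6, hs', h7, h8, h9]
    have e2 : η (q.1 * x + q.2) - η (p.1 * x + p.2) -
        ((q.1 - p.1) • ((x : ℂ) * deriv η (p.1 * x + p.2)) +
          (q.2 - p.2) • deriv η (p.1 * x + p.2)) =
        η (q.1 * x + q.2) - η (p.1 * x + p.2) -
          ((q.1 * x + q.2 - (p.1 * x + p.2) : ℝ) : ℂ) * deriv η (p.1 * x + p.2) := by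
      simp only [Complex.real_smul]
      push_cast
      ring
    rw [e2]
    refine (hC _ _).trans ?_
    have h10 := abs_affine_sub_le hx p q
    have h11 : |q.1 * x + q.2 - (p.1 * x + p.2)| ^ 2 ≤ (2 * ‖q - p‖) ^ 2 :=
      pow_le_pow_left₀ (abs_nonneg _) h10 2
    calc C * |q.1 * x + q.2 - (p.1 * x + p.2)| ^ 2 ≤ C * (2 * ‖q - p‖) ^ 2 :=
          mul_le_mul_of_nonneg_left h11 hC0
      _ = C * 4 * ‖q - p‖ ^ 2 := by ring
  refine hO.trans_isLittleO ?_
  have h0 : (fun q : ℝ × ℝ => ‖q - p‖ ^ 2) =o[𝓝 p] fun q => ‖q - p‖ ^ 1 :=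
    (Asymptotics.isLittleO_pow_sub_sub p one_lt_two).trans_isBigO
      (Asymptotics.isBigO_of_le _ fun q => by simp)
  simpa using h0

end Sample

/-! ### Strong continuity of the pullback -/

section StrongContinuity

/-- Strong continuity of `(ℓ, d) ↦ W_{ℓ,d}` after restriction. -/
theorem continuousOn_pullback (f : L2R) :
    ContinuousOn (fun q : ℝ × ℝ => pullback q.1 q.2 f) {q | 0 < q.1} := by
  refine continuousOn_of_uniform_approx_of_continuousOn fun u hu => ?_
  obtain ⟨ε, hε, hu⟩ := Metric.mem_uniformity_dist.1 hu
  -- Approximate by a continuous compactly supported `g`; as pullbacks are contractions, the error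
  -- is uniform in `(ℓ, d)`.
  obtain ⟨g, hgs, hg, hgc, hgL⟩ := (Lp.memLp f).exists_hasCompactSupport_eLpNorm_sub_le
    (by norm_num) (ε := ENNReal.ofReal (ε / 2)) (by simpa using hε)
  refine ⟨fun q => pullback q.1 q.2 (hgL.toLp g), ?_, fun q hq => hu ?_⟩
  · simp_rw [pullback_eq_sample hgc hgs hgL.coeFn_toLp]
    refine Continuous.continuousOn ?_
    have := continuous_sample hgc hgs
    fun_prop
  · rw [dist_eq_norm, ← map_sub]
    refine (norm_pullback_le hq _).trans_lt ?_
    have e : f - hgL.toLp g = ((Lp.memLp f).sub hgL).toLp _ := by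
      rw [MemLp.toLp_sub (Lp.memLp f) hgL, Lp.toLp_coeFn]
    rw [e, Lp.norm_toLp]
    refine (ENNReal.toReal_mono ENNReal.ofReal_ne_top hg).trans_lt ?_
    rw [ENNReal.toReal_ofReal (by positivity)]
    linarith

end StrongContinuity

/-! ### Extending derivatives by density -/

section Density

/-- Derivatives of a family of operators extend from a subspace to its closure, given a uniform
Lipschitz bound. -/
theorem hasDerivWithinAt_of_mem_topologicalClosure {E F : Type*} [NormedAddCommGroup E]
    [NormedSpace ℂ E] [NormedAddCommGroup F] [NormedSpace ℂ F] [NormedSpace ℝ F] {I : Set ℝ} {t : ℝ}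
    (S : Submodule ℂ E) (L : ℝ → E →L[ℂ] F) (D : E →L[ℂ] F) {M : ℝ}
    (hLip : ∀ p ∈ S, ∀ r ∈ I, ‖L r p - L t p‖ ≤ M * |r - t| * ‖p‖)
    (hder : ∀ p ∈ S, HasDerivWithinAt (fun r => L r p) (D p) I t) {p : E}
    (hp : p ∈ S.topologicalClosure) : HasDerivWithinAt (fun r => L r p) (D p) I t := by
  have hLip' : ∀ p ∈ S.topologicalClosure, ∀ r ∈ I, ‖L r p - L t p‖ ≤ M * |r - t| * ‖p‖ := by
    intro p hp r hr
    have hc : IsClosed {p : E | ‖L r p - L t p‖ ≤ M * |r - t| * ‖p‖} :=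
      isClosed_le (by fun_prop) (by fun_prop)
    exact closure_minimal (fun p hp => hLip p hp r hr) hc hp
  rw [hasDerivWithinAt_iff_isLittleO, Asymptotics.isLittleO_iff]
  intro ε hε
  -- On `p - q`, `|M|` accounts for the increment and `‖D‖` for the linear term; together they cost
  -- at most half of `ε |r - t|`, and `q` takes the other half. The `1` keeps `K` positive.
  set K := |M| + ‖D‖ + 1 with hK
  have hK0 : 0 < K := by positivity
  obtain ⟨q, hq, hpq⟩ := Metric.mem_closure_iff.1 hp (ε / (2 * K)) (by positivity)
  rw [dist_eq_norm] at hpq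
  have h1 := Asymptotics.isLittleO_iff.1 (hasDerivWithinAt_iff_isLittleO.1 (hder q hq))
    (half_pos hε)
  filter_upwards [h1, self_mem_nhdsWithin] with r hr hrI
  have h2 := hLip' (p - q) (Submodule.sub_mem _ hp (subset_closure hq)) r hrI
  have e : L r p - L t p - (r - t) • D p = (L r q - L t q - (r - t) • D q) +
      (L r (p - q) - L t (p - q)) - (r - t) • D (p - q) := by
    simp only [map_sub, smul_sub]
    abel
  have h3 : ‖(r - t) • D (p - q)‖ ≤ |r - t| * (‖D‖ * ‖p - q‖) := by
    rw [norm_smul, Real.norm_eq_abs]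
    exact mul_le_mul_of_nonneg_left (D.le_opNorm _) (abs_nonneg _)
  rw [e]
  refine (norm_sub_le _ _).trans ?_
  have h4 := norm_add_le (L r q - L t q - (r - t) • D q) (L r (p - q) - L t (p - q))
  have h5 : K * ‖p - q‖ ≤ ε / 2 := by
    rw [← le_div_iff₀' hK0, div_div]
    exact hpq.le
  have h6 : M * |r - t| * ‖p - q‖ ≤ |M| * |r - t| * ‖p - q‖ := by
    gcongr
    exact le_abs_self M
  have h7 : |r - t| * (K * ‖p - q‖) ≤ |r - t| * (ε / 2) :=
    mul_le_mul_of_nonneg_left h5 (abs_nonneg _)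
  have h8 : 0 ≤ |r - t| * ‖p - q‖ := by positivity
  rw [Real.norm_eq_abs] at hr ⊢
  rw [hK] at h7
  nlinarith

end Density

/-! ### Differentiating `W(r) Φ` in time -/

section MovingDerivative

variable {I : Set ℝ} {ℓ d : ℝ → ℝ} {t : ℝ}

theorem extend_ae_eq {m e : ℝ} {f : L2 m e} {η : ℝ → ℂ} (hη : Function.support η ⊆ box m e)
    (hf : f =ᵐ[boxMeasure m e] η) : extend m e f =ᵐ[volume] η := by
  refine (extend_coeFn f).trans ?_
  refine ((ae_eq_restrict_iff_indicator_ae_eq (measurableSet_box m e)).1 hf).trans ?_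
  rw [indicator_eq_self.2 hη]

/-- Product rule for `√ℓ η(ℓ x + d)`: differentiating `√ℓ` produces the `1/2` term of the generator.
The derivative of the rescaled function is `ℓ` times the pullback of `η'`, which cancels the
denominators in `ℓ'/ℓ` and `d'/ℓ`. -/
theorem hasDerivWithinAt_pullback_smooth {η : ℝ → ℂ} (h : ContDiff ℝ ∞ η)
    (hs : HasCompactSupport η) {f g : L2R} (hf : f =ᵐ[volume] η) (hg : g =ᵐ[volume] deriv η)
    {ℓ' d' : ℝ} (hℓ : HasDerivWithinAt ℓ ℓ' I t) (hd : HasDerivWithinAt d d' I t)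
    (hpos : 0 < ℓ t) :
    HasDerivWithinAt (fun r => pullback (ℓ r) (d r) f)
      (dilationGen (ℓ t) ℓ' d' (pullback (ℓ t) (d t) f, (ℓ t : ℂ) • pullback (ℓ t) (d t) g)) I t := by
  have h1 : HasDerivWithinAt (fun r => sample h.continuous hs (ℓ r, d r))
      (ℓ' • mulX 1 0 (sample (h.continuous_deriv (by simp)) hs.deriv (ℓ t, d t)) +
        d' • sample (h.continuous_deriv (by simp)) hs.deriv (ℓ t, d t)) I t := by
    have := (hasFDerivAt_sample h hs (ℓ t, d t)).comp_hasDerivWithinAt t (hℓ.prodMk hd)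
    exact this
  have h2 := (hℓ.sqrt hpos.ne').smul h1
  have e1 (r : ℝ) : pullback (ℓ r) (d r) f = √(ℓ r) • sample h.continuous hs (ℓ r, d r) := by
    rw [pullback_eq_sample h.continuous hs hf, RCLike.real_smul_eq_coe_smul (K := ℂ)]
    rfl
  simp_rw [e1]
  refine h2.congr_deriv ?_
  rw [pullback_eq_sample (h.continuous_deriv (by simp)) hs.deriv hg, dilationGen_apply]
  simp only [map_smul]
  simp only [RCLike.real_smul_eq_coe_smul (K := ℂ)]
  have hq : (√(ℓ t) : ℂ) ^ 2 = (ℓ t : ℂ) := by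
    rw [← Complex.ofReal_pow, Real.sq_sqrt hpos.le]
  have hq0 : (√(ℓ t) : ℂ) ≠ 0 := by exact_mod_cast (Real.sqrt_pos.2 hpos).ne'
  simp only [Complex.coe_algebraMap, Complex.ofReal_div, Complex.ofReal_mul, Complex.ofReal_ofNat]
  simp only [← hq]
  match_scalars <;> field_simp

/-- Supplies a velocity bound by the `H¹` size of the pair alone, from which the uniform Lipschitz
constant is obtained. -/
theorem norm_dilationGen_pullback_le {m : ℝ} (hm : 0 < m) (e m' e' : ℝ) (f g : L2R) {N : ℝ}
    (hf : ‖f‖ ≤ N) (hg : ‖g‖ ≤ N) :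
    ‖dilationGen m m' e' (pullback m e f, (m : ℂ) • pullback m e g)‖ ≤
      (|m' / m| * (1 + m) + |e' / m| * m) * N := by
  have hf' : ‖pullback m e f‖ ≤ N := (norm_pullback_le hm f).trans hf
  have hg' : ‖(m : ℂ) • pullback m e g‖ ≤ m * N := by
    rw [norm_smul, Complex.norm_real, Real.norm_of_nonneg hm.le]
    exact mul_le_mul_of_nonneg_left ((norm_pullback_le hm g).trans hg) hm.le
  have hN : 0 ≤ N := (norm_nonneg _).trans hf
  rw [dilationGen_apply]
  refine (norm_add_le _ _).trans ?_
  rw [norm_smul, norm_smul, Complex.norm_real, Complex.norm_real, Real.norm_eq_abs,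
    Real.norm_eq_abs, add_mul, mul_assoc, mul_assoc]
  refine add_le_add (mul_le_mul_of_nonneg_left ?_ (abs_nonneg _))
    (mul_le_mul_of_nonneg_left hg' (abs_nonneg _))
  refine (norm_add_le _ _).trans ?_
  have h1 : ‖(1 / 2 : ℂ) • pullback m e f‖ ≤ N := by
    rw [norm_smul]
    norm_num
    linarith
  have h2 := (norm_mulX_le ((m : ℂ) • pullback m e g)).trans hg'
  linarith

/-- For `(φ, φ')` in the `H¹` closure of the test functions on `Ω_{ℓ(t),d(t)}`, the curve
`r ↦ W_{ℓ(r),d(r)} φ` is differentiable at `r = t`. -/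
theorem hasDerivWithinAt_pullback_extend {a b : ℝ} (hab : a < b)
    (hℓ : ContDiffOn ℝ 1 ℓ (Icc a b)) (hd : ContDiffOn ℝ 1 d (Icc a b))
    (hpos : ∀ t ∈ Icc a b, 0 < ℓ t) (ht : t ∈ Icc a b) {p : L2 (ℓ t) (d t) × L2 (ℓ t) (d t)}
    (hp : p ∈ (testGraph (ℓ t) (d t)).topologicalClosure) :
    HasDerivWithinAt (fun r => pullback (ℓ r) (d r) (extend (ℓ t) (d t) p.1))
      (dilationGen (ℓ t) (derivWithin ℓ (Icc a b) t) (derivWithin d (Icc a b) t)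
        (W (ℓ t) (d t) p.1, (ℓ t : ℂ) • W (ℓ t) (d t) p.2)) (Icc a b) t := by
  have hu := uniqueDiffOn_Icc hab
  have hℓ' (r : ℝ) (hr : r ∈ Icc a b) : HasDerivWithinAt ℓ (derivWithin ℓ (Icc a b) r)
    (Icc a b) r := (hℓ.differentiableOn (by simp) r hr).hasDerivWithinAt
  have hd' (r : ℝ) (hr : r ∈ Icc a b) : HasDerivWithinAt d (derivWithin d (Icc a b) r)
    (Icc a b) r := (hd.differentiableOn (by simp) r hr).hasDerivWithinAt
  have hcont : ContinuousOn (fun r => |derivWithin ℓ (Icc a b) r / ℓ r| * (1 + ℓ r) +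
      |derivWithin d (Icc a b) r / ℓ r| * ℓ r) (Icc a b) := by
    have h0 (r : ℝ) (hr : r ∈ Icc a b) : ℓ r ≠ 0 := (hpos r hr).ne'
    have h1 := hℓ.continuousOn_derivWithin hu le_rfl
    have h2 := hd.continuousOn_derivWithin hu le_rfl
    have h3 := hℓ.continuousOn
    exact ((h1.div h3 h0).abs.mul (continuousOn_const.add h3)).add ((h2.div h3 h0).abs.mul h3)
  obtain ⟨M, hM⟩ := isCompact_Icc.exists_bound_of_continuousOn hcont
  let J : L2 (ℓ t) (d t) →L[ℂ] L2R := (extend (ℓ t) (d t)).toContinuousLinearMap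
  let S := testGraph (ℓ t) (d t)
  -- The derivative is needed at every `r`, not only at `t`, for the mean value inequality. Test
  -- functions on the box at time `t`, extended by zero, are smooth on all of `ℝ`, so the other
  -- boxes may cut them or exceed them.
  have hsmooth : ∀ p ∈ S, ∀ r ∈ Icc a b, HasDerivWithinAt (fun r => pullback (ℓ r) (d r) (J p.1))
      (dilationGen (ℓ r) (derivWithin ℓ (Icc a b) r) (derivWithin d (Icc a b) r)
        (pullback (ℓ r) (d r) (J p.1), (ℓ r : ℂ) • pullback (ℓ r) (d r) (J p.2))) (Icc a b) r := by
    rintro p ⟨η, hη, h1, h2⟩ r hr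
    have hs : Function.support η ⊆ box (ℓ t) (d t) :=
      (subset_tsupport η).trans (hη.supp.trans interior_subset)
    have hs' : Function.support (deriv η) ⊆ box (ℓ t) (d t) :=
      (subset_tsupport _).trans ((tsupport_deriv_subset (𝕜 := ℝ)).trans
        (hη.supp.trans interior_subset))
    exact hasDerivWithinAt_pullback_smooth hη.smooth hη.compact (extend_ae_eq hs h1)
      (extend_ae_eq hs' h2) (hℓ' r hr) (hd' r hr) (hpos r hr)
  let L (r : ℝ) : L2 (ℓ t) (d t) × L2 (ℓ t) (d t) →L[ℂ] L2 1 0 :=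
    pullback (ℓ r) (d r) ∘L J ∘L ContinuousLinearMap.fst ℂ _ _
  let D : L2 (ℓ t) (d t) × L2 (ℓ t) (d t) →L[ℂ] L2 1 0 :=
    dilationGen (ℓ t) (derivWithin ℓ (Icc a b) t) (derivWithin d (Icc a b) t) ∘L
      ((W (ℓ t) (d t) ∘L ContinuousLinearMap.fst ℂ _ _).prod
        ((ℓ t : ℂ) • (W (ℓ t) (d t) ∘L ContinuousLinearMap.snd ℂ _ _)))
  refine hasDerivWithinAt_of_mem_topologicalClosure S L D (M := M) (fun p hp r hr => ?_)
    (fun p hp => ?_) hp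
  · have := (convex_Icc a b).norm_image_sub_le_of_norm_hasDerivWithin_le (C := M * ‖p‖)
      (hsmooth p hp) (fun r hr => ?_) ht hr
    · rw [Real.norm_eq_abs] at this
      exact this.trans_eq (by ring)
    · refine (norm_dilationGen_pullback_le (hpos r hr) _ _ _ _ _ (N := ‖p‖) ?_ ?_).trans ?_
      · exact ((extend (ℓ t) (d t)).norm_map p.1).le.trans (norm_fst_le p)
      · exact ((extend (ℓ t) (d t)).norm_map p.2).le.trans (norm_snd_le p)
      · exact mul_le_mul_of_nonneg_right ((le_abs_self _).trans (hM r hr)) (norm_nonneg _)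
  · have := hsmooth p hp t ht
    refine this.congr_deriv ?_
    change dilationGen _ _ _ (pullback _ _ (extend _ _ _), _ • pullback _ _ (extend _ _ _)) = _
    rw [pullback_extend, pullback_extend]
    rfl

end MovingDerivative

/-! ### Form domains and form values of the two Hamiltonians -/

section FormDomain

variable {ℓ d : ℝ}

theorem mem_formDomain_boxHamiltonian_iff {ψ : L2 ℓ d} :
    ψ ∈ formDomain (boxHamiltonian ℓ d) ↔ ∃ u g, GraphApprox u (ψ, g) :=
  (isPerturbedLaplacian_dirLaplacian ℓ d).mem_formDomain_iff

theorem mem_formDomain_auxHamiltonian_iff (hℓ : 0 < ℓ) {ℓ' d' : ℝ} {ψ : L2 1 0} :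
    ψ ∈ formDomain (auxHamiltonian ℓ ℓ' d') ↔ ∃ u g, GraphApprox u (ψ, g) :=
  (isPerturbedLaplacian_auxAction hℓ ℓ' d').mem_formDomain_iff

theorem isFormValue_boxHamiltonian_iff {u v : ℕ → dirDomain ℓ d} {p q : L2 ℓ d × L2 ℓ d}
    (hu : GraphApprox u p) (hv : GraphApprox v q) {z : ℂ} :
    IsFormValue (boxHamiltonian ℓ d) p.1 q.1 z ↔ z = inner ℂ p.2 q.2 := by
  refine ((isPerturbedLaplacian_dirLaplacian ℓ d).isFormValue_iff hu hv).trans ?_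
  simp

theorem isFormValue_auxHamiltonian_iff (hℓ : 0 < ℓ) {ℓ' d' : ℝ} {u v : ℕ → dirDomain 1 0}
    {p q : L2 1 0 × L2 1 0} (hu : GraphApprox u p) (hv : GraphApprox v q) {z : ℂ} :
    IsFormValue (auxHamiltonian ℓ ℓ' d') p.1 q.1 z ↔
      z = ((1 / ℓ ^ 2 : ℝ) : ℂ) * inner ℂ p.2 q.2 +
        Complex.I * inner ℂ p.1 (dilationGen ℓ ℓ' d' q) := by
  refine ((isPerturbedLaplacian_auxAction hℓ ℓ' d').isFormValue_iff hu hv).trans ?_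
  rw [smul_apply, inner_smul_right, neg_mul, sub_neg_eq_add]

/-- Both form domains consist of the `H¹` limits from `𝒟_Dir`, and `W` carries approximating
sequences to approximating sequences. -/
theorem W_mem_formDomain (hℓ : 0 < ℓ) {ℓ' d' : ℝ} {ψ : L2 ℓ d}
    (h : ψ ∈ formDomain (boxHamiltonian ℓ d)) :
    W ℓ d ψ ∈ formDomain (auxHamiltonian ℓ ℓ' d') := by
  obtain ⟨u, g, hu⟩ := mem_formDomain_boxHamiltonian_iff.1 h
  exact (mem_formDomain_auxHamiltonian_iff hℓ).2 ⟨_, _, (isScaling_W d hℓ).graphApprox hu⟩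

theorem adjoint_W_mem_formDomain (hℓ : 0 < ℓ) {ℓ' d' : ℝ} {ψ : L2 1 0}
    (h : ψ ∈ formDomain (auxHamiltonian ℓ ℓ' d')) :
    (W ℓ d).adjoint ψ ∈ formDomain (boxHamiltonian ℓ d) := by
  obtain ⟨u, g, hu⟩ := (mem_formDomain_auxHamiltonian_iff hℓ).1 h
  have hu' := (isScaling_adjoint_W d hℓ).graphApprox hu
  exact mem_formDomain_boxHamiltonian_iff.2 ⟨_, _, hu'⟩

theorem isSemiboundedHamiltonian_boxHamiltonian (I : Set ℝ) (ℓ d : ℝ → ℝ) :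
    IsSemiboundedHamiltonian (𝓗 := fun t => L2 (ℓ t) (d t)) I
      (fun t => boxHamiltonian (ℓ t) (d t)) := by
  refine ⟨fun t _ => ⟨dense_domain_boxHamiltonian _ _, isSelfAdjoint_boxHamiltonian _ _⟩, 0,
    fun t _ ψ => ?_⟩
  rw [quadForm_boxHamiltonian, Complex.ofReal_re, neg_zero, zero_mul]
  positivity

end FormDomain

/-! ### Continuity of products of contractions and of `W†` -/

section Continuity

/-- A contraction does not enlarge the error in its argument, so strong continuity at the limiting
vector suffices. -/
theorem continuousWithinAt_apply_of_norm_le {X E F : Type*} [TopologicalSpace X]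
    [NormedAddCommGroup E] [NormedSpace ℂ E] [NormedAddCommGroup F] [NormedSpace ℂ F]
    {s : Set X} {p₀ : X} (A : X → E →L[ℂ] F) (hA : ∀ p ∈ s, ∀ x, ‖A p x‖ ≤ ‖x‖) {x : X → E}
    (hc : ContinuousWithinAt (fun p => A p (x p₀)) s p₀) (hx : ContinuousWithinAt x s p₀) :
    ContinuousWithinAt (fun p => A p (x p)) s p₀ := by
  have h1 : Tendsto (fun p => A p (x p - x p₀)) (𝓝[s] p₀) (𝓝 0) := by
    have h2 : Tendsto (fun p => ‖x p - x p₀‖) (𝓝[s] p₀) (𝓝 0) :=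
      tendsto_iff_norm_sub_tendsto_zero.1 hx
    refine squeeze_zero_norm' ?_ h2
    filter_upwards [self_mem_nhdsWithin] with p hp using hA p hp _
  have h3 := h1.add hc
  rw [zero_add] at h3
  refine h3.congr fun p => ?_
  rw [← map_add, sub_add_cancel]

/-- Strong continuity of `(ℓ, d) ↦ W†_{ℓ,d}`, as a map into `L²(ℝ)`. -/
theorem continuousOn_extend_adjoint_W (f : L2 1 0) :
    ContinuousOn (fun q : ℝ × ℝ => extend q.1 q.2 ((W q.1 q.2).adjoint f)) {q | 0 < q.1} := by
  have hn (q : ℝ × ℝ) (hq : 0 < q.1) : ‖extend q.1 q.2 ((W q.1 q.2).adjoint f)‖ = ‖f‖ := by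
    rw [LinearIsometry.norm_map, norm_adjoint_W hq]
  intro p hp
  set e := extend p.1 p.2 ((W p.1 p.2).adjoint f) with he
  refine tendsto_iff_norm_sub_tendsto_zero.2 ?_
  -- All the vectors have norm `‖f‖`, so their squared distance to `e` is `2 ‖f‖²` minus twice the
  -- real part of this scalar product. Continuity of the pullback on the fixed vector `e` therefore
  -- suffices.
  have h1 : Tendsto (fun q : ℝ × ℝ => (inner ℂ (pullback q.1 q.2 e) f : ℂ)) (𝓝[{q | 0 < q.1}] p)
      (𝓝 (inner ℂ (pullback p.1 p.2 e) f)) :=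
    Tendsto.inner (continuousOn_pullback e p hp) tendsto_const_nhds
  have h2 : (inner ℂ (pullback p.1 p.2 e) f : ℂ) = ((‖f‖ ^ 2 : ℝ) : ℂ) := by
    rw [he, pullback_extend, W_adjoint_apply hp, inner_self_eq_norm_sq_to_K]
    simp
  rw [h2] at h1
  have h3 := ((Complex.continuous_re.tendsto _).comp h1).const_mul 2
  have h4 := (h3.const_sub (2 * ‖f‖ ^ 2)).sqrt
  rw [Complex.ofReal_re, sub_self, Real.sqrt_zero] at h4
  refine h4.congr' ?_
  filter_upwards [self_mem_nhdsWithin] with q hq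
  rw [Function.comp_apply, ← inner_extend_adjoint_W, ← Real.sqrt_sq (norm_nonneg (_ - e)),
    norm_sub_rev, @norm_sub_sq ℂ, hn q hq, he, hn p hp]
  congr 1
  simp only [RCLike.re_to_complex]
  ring

end Continuity

/-! ### The conjugated propagator and the weak product rule -/

section Propagator

variable {I : Set ℝ} {ℓ d : ℝ → ℝ} {Ut : ℝ → ℝ → L2 1 0 →L[ℂ] L2 1 0}

/-- Joint strong continuity of a unitary propagator on a fixed Hilbert space. -/
theorem IsUnitaryPropagator.continuousOn_apply {H : Type*} [NormedAddCommGroup H]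
    [InnerProductSpace ℂ H] [CompleteSpace H] {V : ℝ → ℝ → H →L[ℂ] H}
    (h : IsUnitaryPropagator (𝓗 := fun _ => H) I (fun _ => LinearIsometry.id) V) (f : H) :
    ContinuousOn (fun p : ℝ × ℝ => V p.1 p.2 f) (I ×ˢ I) := by
  have e : (LinearIsometry.id : H →ₗᵢ[ℂ] H).toContinuousLinearMap.adjoint f = f := by
    refine ext_inner_right ℂ fun g => ?_
    rw [ContinuousLinearMap.adjoint_inner_left]
    rfl
  refine (h.continuous f).congr fun p _ => ?_
  change V p.1 p.2 f = V p.1 p.2 _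
  rw [e]

theorem IsUnitaryPropagator.conj_W (hℓ : ContinuousOn ℓ I) (hd : ContinuousOn d I)
    (hpos : ∀ t ∈ I, 0 < ℓ t)
    (h : IsUnitaryPropagator (𝓗 := fun _ => L2 1 0) I (fun _ => LinearIsometry.id) Ut) :
    IsUnitaryPropagator (𝓗 := fun t => L2 (ℓ t) (d t)) I (fun t => extend (ℓ t) (d t))
      (fun t s => (W (ℓ t) (d t)).adjoint ∘L Ut t s ∘L W (ℓ s) (d s)) := by
  refine ⟨fun t ht s hs ψ => ?_, fun t ht s hs => ?_, fun t ht s hs r hr => ?_, fun ψ => ?_⟩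
  · change ‖(W (ℓ t) (d t)).adjoint (Ut t s (W (ℓ s) (d s) ψ))‖ = _
    rw [norm_adjoint_W (hpos t ht), h.norm_map t ht s hs, norm_W (hpos s hs)]
  · have h1 : Function.Surjective (W (ℓ t) (d t)).adjoint := fun f =>
      ⟨W (ℓ t) (d t) f, adjoint_W_apply (hpos t ht) f⟩
    exact h1.comp ((h.surjective t ht s hs).comp (W_surjective (hpos s hs)))
  · ext1 ψ
    change (W (ℓ t) (d t)).adjoint (Ut t s (W (ℓ s) (d s) ((W (ℓ s) (d s)).adjoint
      (Ut s r (W (ℓ r) (d r) ψ))))) = (W (ℓ t) (d t)).adjoint (Ut t r (W (ℓ r) (d r) ψ))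
    rw [W_adjoint_apply (hpos s hs), ← h.comp t ht s hs r hr]
    rfl
  · have hc1 : ContinuousOn (fun p : ℝ × ℝ => (ℓ p.1, d p.1)) (I ×ˢ I) :=
      (hℓ.comp continuousOn_fst fun p hp => hp.1).prodMk
        (hd.comp continuousOn_fst fun p hp => hp.1)
    have hc2 : ContinuousOn (fun p : ℝ × ℝ => (ℓ p.2, d p.2)) (I ×ˢ I) :=
      (hℓ.comp continuousOn_snd fun p hp => hp.2).prodMk
        (hd.comp continuousOn_snd fun p hp => hp.2)
    -- In `L²(ℝ)` the propagator is the pullback at `s`, then `Ũ(t,s)`, then `W†` and extension at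
    -- `t`; continuity is passed along this chain of contractions.
    have h1 : ContinuousOn (fun p : ℝ × ℝ => pullback (ℓ p.2) (d p.2) ψ) (I ×ˢ I) := by
      have := (continuousOn_pullback ψ).comp hc2 fun p hp => hpos p.2 hp.2
      exact this
    have h2 : ContinuousOn (fun p : ℝ × ℝ => Ut p.1 p.2 (pullback (ℓ p.2) (d p.2) ψ))
        (I ×ˢ I) := fun p hp =>
      continuousWithinAt_apply_of_norm_le (fun p : ℝ × ℝ => Ut p.1 p.2)
        (fun q hq x => (h.norm_map q.1 hq.1 q.2 hq.2 x).le) (h.continuousOn_apply _ p hp) (h1 p hp)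
    intro p hp
    refine continuousWithinAt_apply_of_norm_le (fun p : ℝ × ℝ =>
      (extend (ℓ p.1) (d p.1)).toContinuousLinearMap ∘L (W (ℓ p.1) (d p.1)).adjoint)
      (fun q hq x => ?_) ?_ (h2 p hp)
    · change ‖extend _ _ _‖ ≤ _
      rw [LinearIsometry.norm_map]
      exact (norm_adjoint_W (hpos q.1 hq.1) x).le
    · have := (continuousOn_extend_adjoint_W (Ut p.1 p.2 (pullback (ℓ p.2) (d p.2) ψ))).comp hc1
        fun p hp => hpos p.1 hp.1
      exact this p hp

/-- Product rule for scalar products with a weakly differentiable curve. -/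
theorem hasDerivWithinAt_inner_of_weak {E : Type*} [NormedAddCommGroup E] [InnerProductSpace ℂ E]
    [NormedSpace ℝ E] [IsScalarTower ℝ ℂ E] {I : Set ℝ} {t : ℝ} {F χ : ℝ → E} {F' : E} {w : ℂ}
    (hF : HasDerivWithinAt F F' I t) (hχ : ContinuousWithinAt χ I t)
    (hw : HasDerivWithinAt (fun r => (inner ℂ (F t) (χ r) : ℂ)) w I t) :
    HasDerivWithinAt (fun r => (inner ℂ (F r) (χ r) : ℂ)) (inner ℂ F' (χ t) + w) I t := by
  rw [hasDerivWithinAt_iff_tendsto_slope] at hF hw ⊢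
  -- The difference quotient splits into `⟨slope F, χ(r)⟩` and the slope of `⟨F(t), χ⟩`. The first
  -- needs only continuity of `χ`, the second only its weak derivative.
  have h1 : Tendsto (fun r => (inner ℂ (slope F t r) (χ r) : ℂ)) (𝓝[I \ {t}] t)
      (𝓝 (inner ℂ F' (χ t))) :=
    hF.inner (hχ.mono_left (nhdsWithin_mono _ sdiff_subset))
  refine (h1.add hw).congr fun r => ?_
  simp only [slope, vsub_eq_sub]
  rw [RCLike.real_smul_eq_coe_smul (K := ℂ), inner_smul_left, RCLike.conj_ofReal, inner_sub_left,
    Complex.real_smul, Complex.real_smul]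
  change (((r - t)⁻¹ : ℝ) : ℂ) * _ + _ = _
  ring

end Propagator

end MovingBox

/-! ### Transfer of the weak Schrödinger equation -/

theorem corollary1 (a b : ℝ) (hab : a < b) (ℓ d : ℝ → ℝ)
    (hℓ : ContDiffOn ℝ 2 ℓ (Set.Icc a b)) (hd : ContDiffOn ℝ 2 d (Set.Icc a b))
    (hpos : ∀ t ∈ Set.Icc a b, 0 < ℓ t)
    (Ut : ℝ → ℝ → MovingBox.L2 1 0 →L[ℂ] MovingBox.L2 1 0)
    (hUt : MovingBox.IsWeakSolution (𝓗 := fun _ => MovingBox.L2 1 0) (Set.Icc a b)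
      (fun _ => LinearIsometry.id)
      (fun t => MovingBox.auxHamiltonian (ℓ t) (derivWithin ℓ (Set.Icc a b) t)
        (derivWithin d (Set.Icc a b) t)) Ut) :
    MovingBox.IsSemiboundedHamiltonian (𝓗 := fun t => MovingBox.L2 (ℓ t) (d t)) (Set.Icc a b)
        (fun t => MovingBox.boxHamiltonian (ℓ t) (d t)) ∧
      MovingBox.IsWeakSolution (𝓗 := fun t => MovingBox.L2 (ℓ t) (d t)) (Set.Icc a b)
        (fun t => MovingBox.extend (ℓ t) (d t))
        (fun t => MovingBox.boxHamiltonian (ℓ t) (d t))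
        (fun t s => (MovingBox.W (ℓ t) (d t)).adjoint ∘L Ut t s ∘L MovingBox.W (ℓ s) (d s)) := by
  open MovingBox in
  refine ⟨isSemiboundedHamiltonian_boxHamiltonian _ ℓ d,
    hUt.propagator.conj_W hℓ.continuousOn hd.continuousOn hpos, fun s hs Ψ₀ hΨ₀ t ht => ?_,
    fun s hs Ψ₀ hΨ₀ => ?_, fun s hs Ψ₀ hΨ₀ t ht Φ hΦ => ?_⟩
  · exact adjoint_W_mem_formDomain (hpos t ht)
      (hUt.mem_formDomain s hs _ (W_mem_formDomain (hpos s hs) hΨ₀) t ht)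
  · change (W (ℓ s) (d s)).adjoint (Ut s s (W (ℓ s) (d s) Ψ₀)) = Ψ₀
    rw [hUt.initial s hs _ (W_mem_formDomain (hpos s hs) hΨ₀), adjoint_W_apply (hpos s hs)]
  · have hℓt := hpos t ht
    have hΨ := W_mem_formDomain (ℓ' := derivWithin ℓ (Set.Icc a b) s)
      (d' := derivWithin d (Set.Icc a b) s) (hpos s hs) hΨ₀
    obtain ⟨u, g, hu⟩ := mem_formDomain_boxHamiltonian_iff.1 hΦ
    obtain ⟨v, k, hv⟩ := (mem_formDomain_auxHamiltonian_iff hℓt).1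
      (hUt.mem_formDomain s hs _ hΨ t ht)
    obtain ⟨w, hw, hform⟩ := hUt.weak s hs _ hΨ t ht _ (W_mem_formDomain hℓt hΦ)
    have hu' := (isScaling_W (d t) hℓt).graphApprox hu
    have hv' := (isScaling_adjoint_W (d t) hℓt).graphApprox hv
    have hform' := (isFormValue_auxHamiltonian_iff hℓt hu' hv).1 hform
    have hderiv := hasDerivWithinAt_pullback_extend hab (hℓ.of_le (by norm_num))
      (hd.of_le (by norm_num)) hpos ht hu.mem_closure
    have hχ : ContinuousWithinAt (fun r => Ut r s (W (ℓ s) (d s) Ψ₀)) (Set.Icc a b) t :=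
      ((hUt.propagator.continuousOn_apply (W (ℓ s) (d s) Ψ₀)).comp
        (continuousOn_id.prodMk continuousOn_const) fun r hr => ⟨hr, hs⟩) t ht
    -- The product rule applies to `W(r) Φ` and `Ũ(r,s) W(s) Ψ₀`; at `r = t` the pullback of the
    -- extension of `Φ` is `W(t) Φ`, where the weak equation for `Ũ` gives `w`.
    refine ⟨_, (hasDerivWithinAt_inner_of_weak hderiv hχ (w := w) ?_).congr_of_mem
      (fun r hr => ?_) ht, ?_⟩
    · rw [pullback_extend]
      exact hw
    · exact inner_extend_adjoint_W _ _
    · refine (isFormValue_boxHamiltonian_iff hu hv').2 ?_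
      -- Antisymmetry cancels the generator terms. The two gradient terms then agree: the factors
      -- are `ℓ⁻² · ℓ` on the unit box and `ℓ⁻¹` from `W†` on the moving box.
      have hanti := inner_dilationGen (ℓ t) (derivWithin ℓ (Set.Icc a b) t)
        (derivWithin d (Set.Icc a b) t) hu'.mem_closure
        (hasWeakDeriv_of_mem_closure hv.mem_closure)
      have hc : (ℓ t : ℂ) ≠ 0 := by exact_mod_cast hℓt.ne'
      rw [mul_add, hform', hanti]
      simp only [inner_smul_left, inner_smul_right, ContinuousLinearMap.adjoint_inner_right,
        Complex.conj_ofReal]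
      push_cast
      field_simp
      ring
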